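/- For a real-valued function $\varphi$ on a domain $D\subset\mathbb C^n$ let $L^2(D,\varphi)$ and $L^2_{(0,1)}(D,\varphi)$ be the Hilbert spaces of functions $u$, respectively $(0,1)$-forms $f=\sum_j f_j\,d\bar z_j$, with $\|u\|_\varphi^2=\int_D|u|^2e^{-\varphi}d\lambda<\infty$, respectively $\|f\|_\varphi^2=\int_D\sum_j|f_j|^2e^{-\varphi}d\lambda<\infty$; $\bar\partial$ is taken in the sense of distributions, and as an operator $L^2(D,\varphi)\to L^2_{(0,1)}(D,\varphi)$ it has its maximal domain. For $\psi:D\to\mathbb R$, the pair $(D,\psi)$ is called $L^2$-optimal if for every smooth strictly plurisubharmonic function $\phi$ on $\mathbb C^n$ and every $\bar\partial$-closed $f\in L^2_{(0,1)}(D,\phi+\psi)$ there is a solution $u$ of $\bar\partial u=f$ on $D$ with $$\int_D|u|^2e^{-\phi-\psi}d\lambda\le\int_D\langle B_\phi^{-1}f,f\rangle e^{-\phi-\psi}d\lambda,\qquad B_\phi f=\sum_{j,k}\frac{\partial^2\phi}{\partial z_j\partial\bar z_k}f_j\,d\bar z_k,$$ provided the right-hand side is finite. **Theorem.** Let $D\subset\mathbb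 C^n$ be a domain and let $g=(g_1,\dots,g_p)$ be holomorphic functions on $D$ with $0<\inf_D|g|^2\le\sup_D|g|^2<\infty$ and $\sup_D|\partial g|^2<\infty$, where $|g|^2=\sum_i|g_i|^2$ and $|\partial g|^2=\sum_{i,k}|\partial g_i/\partial z_k|^2$. Then there are $a_0>0$ and $\delta>0$, depending only on $D$ and $g$, such that for every $a\ge a_0$, with $\phi(z)=a\|z\|^2$, and for every upper semi-continuous $\psi:D\to\mathbb R$ such that $(D,\psi)$ is $L^2$-optimal, the following hold. 1. Suppose that $\psi$ is continuous. Let $T_1:L^2(D,\phi+\psi)^{\oplus p}\to L^2(D,\phi+\psi)$, $T_1h=\sum_ig_ih_i$, and let $T_2:L^2(D,\phi+\psi)^{\oplus p}\to L^2_{(0,1)}(D,\phi+\psi)^{\oplus p}$, $T_2h=(\bar\partial h_1,\dots,\bar\partial h_p)$, a closed densely defined operator. Then $$\|T_1^*u+T_2^*v\|_{\phi+\psi}^2\ge\delta\,\|u\|_{\phi+\psi}^2$$ for all $u\in L^2(D,\phi+\psi)$ with $\bar\partial u=0$ and all $v\in\mathrm{Dom}(T_2^*)\cap(\mathrm{Ker}\,T_2^*)^\perp$.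 2. For every holomorphic $f\in L^2(D,\phi+\psi)$ there are holomorphic $h_1,\dots,h_p\in L^2(D,\phi+\psi)$ with $f=\sum_{i=1}^ph_ig_i$ on $D$. -/

import Mathlib

namespace L2Division

open MeasureTheory
open scoped ENNReal ContDiff ComplexOrder

variable {n p : ℕ}

/-! Points of `ℂⁿ` are functions `Fin n → ℂ`, with the Lebesgue measure `volume`. The Euclidean
norm is always written out as `∑ i, ‖z i‖ ^ 2`; the sup norm of `Fin n → ℂ` is only used through
the topology and the notion of derivative, for which the choice of norm is immaterial. -/

/-- The Wirtinger derivative `∂F/∂z_j`. -/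
noncomputable def dz (j : Fin n) (F : (Fin n → ℂ) → ℂ) (z : Fin n → ℂ) : ℂ :=
  (1 / 2 : ℂ) * (fderiv ℝ F z (Pi.single j 1) - Complex.I * fderiv ℝ F z (Pi.single j Complex.I))

/-- The Wirtinger derivative `∂F/∂z̄_j`. -/
noncomputable def dzbar (j : Fin n) (F : (Fin n → ℂ) → ℂ) (z : Fin n → ℂ) : ℂ :=
  (1 / 2 : ℂ) * (fderiv ℝ F z (Pi.single j 1) + Complex.I * fderiv ℝ F z (Pi.single j Complex.I))

/-- The measure `e^{-φ} dλ` on `D`; `L²(D, φ)` is `L²` of this measure. -/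
noncomputable def weightedMeasure (D : Set (Fin n → ℂ)) (φ : (Fin n → ℂ) → ℝ) :
    Measure (Fin n → ℂ) :=
  (volume.restrict D).withDensity fun z => ENNReal.ofReal (Real.exp (-φ z))

/-- Smooth complex valued functions with compact support in `D`. -/
def IsTestFunction (D : Set (Fin n → ℂ)) (χ : (Fin n → ℂ) → ℂ) : Prop :=
  ContDiff ℝ ∞ χ ∧ HasCompactSupport χ ∧ tsupport χ ⊆ D

/-- `∂̄u = f = ∑ f_j dz̄_j` on `D` in the sense of distributions, for locally integrable `u, f`. -/
def IsWeakDbar (D : Set (Fin n → ℂ)) (u : (Fin n → ℂ) → ℂ) (f : Fin n → (Fin n → ℂ) → ℂ) : Prop :=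
  LocallyIntegrableOn u D volume ∧ (∀ j, LocallyIntegrableOn (f j) D volume) ∧
    ∀ χ, IsTestFunction D χ → ∀ j,
      ∫ z in D, u z * dzbar j χ z = -∫ z in D, f j z * χ z

/-- The `(0,1)`-form `∑ f_j dz̄_j` is `∂̄`-closed on `D` in the sense of distributions:
`∂f_j/∂z̄_k = ∂f_k/∂z̄_j` for all `j, k`. -/
def IsDbarClosed (D : Set (Fin n → ℂ)) (f : Fin n → (Fin n → ℂ) → ℂ) : Prop :=
  (∀ j, LocallyIntegrableOn (f j) D volume) ∧
    ∀ χ, IsTestFunction D χ → ∀ j k,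
      ∫ z in D, f j z * dzbar k χ z = ∫ z in D, f k z * dzbar j χ z

/-- The matrix of the operator `B_φ` on `(0,1)`-forms at `z`: the coefficient of `dz̄_k` in `B_φ f`
is `∑ j, (∂²φ/∂z_j∂z̄_k) f_j`. -/
noncomputable def curvatureMatrix (φ : (Fin n → ℂ) → ℝ) (z : Fin n → ℂ) :
    Matrix (Fin n) (Fin n) ℂ :=
  Matrix.of fun k j => dz j (dzbar k fun w => (φ w : ℂ)) z

/-- `φ` is a smooth strictly plurisubharmonic function on `ℂⁿ`: its Levi form
`∑ (∂²φ/∂z_j∂z̄_k) ξ_j ξ̄_k` is positive definite at every point. -/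
def IsSmoothStrictlyPsh (φ : (Fin n → ℂ) → ℝ) : Prop :=
  ContDiff ℝ ∞ φ ∧ ∀ z, (curvatureMatrix φ z).PosDef

/-- `⟨B_φ⁻¹ f, f⟩` at the point `z`. -/
noncomputable def curvatureInvForm (φ : (Fin n → ℂ) → ℝ) (f : Fin n → (Fin n → ℂ) → ℂ)
    (z : Fin n → ℂ) : ℝ :=
  (∑ k, ((curvatureMatrix φ z)⁻¹.mulVec fun j => f j z) k * star (f k z)).re

/-- The pair `(D, ψ)` is `L²`-optimal: for every smooth strictly plurisubharmonic `φ` on `ℂⁿ` and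
every `∂̄`-closed `(0,1)`-form `f ∈ L²(D, φ + ψ)`, the equation `∂̄u = f` has a solution on `D` with
`∫_D |u|² e^{-φ-ψ} ≤ ∫_D ⟨B_φ⁻¹ f, f⟩ e^{-φ-ψ}`, provided the right-hand side is finite. -/
def IsL2Optimal (D : Set (Fin n → ℂ)) (ψ : (Fin n → ℂ) → ℝ) : Prop :=
  ∀ φ : (Fin n → ℂ) → ℝ, IsSmoothStrictlyPsh φ →
    ∀ f : Fin n → (Fin n → ℂ) → ℂ,
      (∀ j, MemLp (f j) 2 (weightedMeasure D (φ + ψ))) → IsDbarClosed D f →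
      ∫⁻ z, ENNReal.ofReal (curvatureInvForm φ f z) ∂weightedMeasure D (φ + ψ) < ⊤ →
      ∃ u : (Fin n → ℂ) → ℂ, MemLp u 2 (weightedMeasure D (φ + ψ)) ∧ IsWeakDbar D u f ∧
        ∫⁻ z, ‖u z‖ₑ ^ 2 ∂weightedMeasure D (φ + ψ) ≤
          ∫⁻ z, ENNReal.ofReal (curvatureInvForm φ f z) ∂weightedMeasure D (φ + ψ)

/-- The Hilbert space `L²(D, φ)`. -/
abbrev L2 (D : Set (Fin n → ℂ)) (φ : (Fin n → ℂ) → ℝ) : Type :=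
  Lp ℂ 2 (weightedMeasure D φ)

/-- The Hilbert space `L²_{(0,1)}(D, φ)` of `(0,1)`-forms `∑ f_j dz̄_j`. -/
abbrev L2Form (D : Set (Fin n → ℂ)) (φ : (Fin n → ℂ) → ℝ) : Type :=
  PiLp 2 fun _ : Fin n => L2 D φ

theorem IsTestFunction.continuous_dzbar {D : Set (Fin n → ℂ)} {χ : (Fin n → ℂ) → ℂ}
    (h : IsTestFunction D χ) (j : Fin n) : Continuous (dzbar j χ) := by
  have h1 : Continuous (fderiv ℝ χ) := h.1.continuous_fderiv (by simp)
  unfold dzbar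
  fun_prop

theorem support_dzbar {χ : (Fin n → ℂ) → ℂ} (j : Fin n) : Function.support (dzbar j χ) ⊆ tsupport χ := by
  intro z hz
  by_contra h
  apply hz
  have : fderiv ℝ χ z = 0 := by
    by_contra h'
    exact h (support_fderiv_subset ℝ h')
  simp [dzbar, this]

/-- A locally integrable function times a continuous function supported in a compact subset of `D`
is integrable on `D`. -/
theorem integrable_mul_of_support {D : Set (Fin n → ℂ)} {u w : (Fin n → ℂ) → ℂ}
    {χ : (Fin n → ℂ) → ℂ} (h : IsTestFunction D χ)
    (hu : LocallyIntegrableOn u D volume) (hw : Continuous w)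
    (hs : Function.support w ⊆ tsupport χ) :
    Integrable (fun z => u z * w z) (volume.restrict D) := by
  have hK : IntegrableOn (fun z => u z * w z) (tsupport χ) volume :=
    (hu.integrableOn_compact_subset h.2.2 h.2.1).mul_continuousOn hw.continuousOn h.2.1
  have : Integrable (fun z => u z * w z) volume :=
    (integrableOn_iff_integrable_of_support_subset
      ((Function.support_mul_subset_right u w).trans hs)).1 hK
  exact this.restrict

/-- The graph of `∂̄ : L²(D, φ) → L²_{(0,1)}(D, φ)`: pairs with `∂̄u = f` in the sense of
distributions. Elements of `L²` are classes modulo null sets, so the condition is put on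
representatives. -/
def dbarGraph (D : Set (Fin n → ℂ)) (φ : (Fin n → ℂ) → ℝ) :
    Submodule ℂ (L2 D φ × L2Form D φ) where
  carrier := {x | ∃ (u : (Fin n → ℂ) → ℂ) (f : Fin n → (Fin n → ℂ) → ℂ),
    x.1 =ᵐ[weightedMeasure D φ] u ∧ (∀ j, x.2 j =ᵐ[weightedMeasure D φ] f j) ∧ IsWeakDbar D u f}
  zero_mem' := by
    refine ⟨0, 0, Lp.coeFn_zero _ _ _, fun j => Lp.coeFn_zero _ _ _, ?_, fun j => ?_, ?_⟩
    · exact locallyIntegrableOn_zero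
    · exact locallyIntegrableOn_zero
    · intro χ hχ j
      simp
  add_mem' := by
    rintro x y ⟨u, f, hu, hf, hu1, hf1, H⟩ ⟨v, g, hv, hg, hv1, hg1, H'⟩
    refine ⟨u + v, f + g, (Lp.coeFn_add _ _).trans (hu.add hv),
      fun j => (Lp.coeFn_add _ _).trans ((hf j).add (hg j)), hu1.add hv1,
      fun j => (hf1 j).add (hg1 j), fun χ hχ j => ?_⟩
    have hc := hχ.1.continuous
    have hd := hχ.continuous_dzbar j
    have hs := support_dzbar (χ := χ) j
    simp only [Pi.add_apply, add_mul]
    rw [integral_add (integrable_mul_of_support hχ hu1 hd hs)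
        (integrable_mul_of_support hχ hv1 hd hs),
      integral_add (integrable_mul_of_support hχ (hf1 j) hc subset_closure)
        (integrable_mul_of_support hχ (hg1 j) hc subset_closure), H χ hχ j, H' χ hχ j, neg_add]
  smul_mem' := by
    rintro c x ⟨u, f, hu, hf, hu1, hf1, H⟩
    refine ⟨c • u, c • f, (Lp.coeFn_smul _ _).trans (hu.const_smul c),
      fun j => (Lp.coeFn_smul _ _).trans ((hf j).const_smul c), hu1.smul c,
      fun j => (hf1 j).smul c, fun χ hχ j => ?_⟩
    simp only [Pi.smul_apply, smul_eq_mul, mul_assoc]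
    rw [integral_const_mul, integral_const_mul, H χ hχ j, mul_neg]

/-- The densely defined operator `∂̄ : L²(D, φ) → L²_{(0,1)}(D, φ)`, on its maximal domain of all
`u` whose distributional `∂̄u` is in `L²_{(0,1)}(D, φ)`. -/
noncomputable def dbar (D : Set (Fin n → ℂ)) (φ : (Fin n → ℂ) → ℝ) :
    L2 D φ →ₗ.[ℂ] L2Form D φ :=
  (dbarGraph D φ).toLinearPMap

/-- The set `dbarGraph D φ` is the graph of the operator `dbar D φ`. -/
theorem dbar_graph {D : Set (Fin n → ℂ)} (hD : IsOpen D) {φ : (Fin n → ℂ) → ℝ}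
    (hφ : AEMeasurable φ (volume.restrict D)) : (dbar D φ).graph = dbarGraph D φ := by
  apply Submodule.toLinearPMap_graph_eq
  rintro ⟨x, y⟩ ⟨u, f, hu, hf, hu1, hf1, H⟩ rfl
  have hac : volume.restrict D ≪ weightedMeasure D φ :=
    withDensity_absolutelyContinuous' (by fun_prop)
      (Filter.Eventually.of_forall fun z => by simp [Real.exp_pos])
  have hu0 : u =ᵐ[volume.restrict D] 0 :=
    hac.ae_le ((hu.symm.trans (Lp.coeFn_zero _ _ _)))
  ext j : 1
  have hfj : ∀ᵐ z ∂(volume : Measure (Fin n → ℂ)), z ∈ D → f j z = 0 := by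
    refine hD.ae_eq_zero_of_integral_contDiff_smul_eq_zero (hf1 j) fun g hg hgc hgs => ?_
    have hχ : IsTestFunction D fun z => (g z : ℂ) := by
      have hsub : tsupport (fun z => (g z : ℂ)) ⊆ tsupport g :=
        closure_mono fun z hz => by simpa using hz
      exact ⟨Complex.ofRealCLM.contDiff.comp hg,
        hgc.of_isClosed_subset (isClosed_tsupport _) hsub, hsub.trans hgs⟩
    have h1 := H _ hχ j
    have h2 : ∫ z in D, u z * dzbar j (fun z => (g z : ℂ)) z = 0 := by
      refine integral_eq_zero_of_ae (hu0.mono fun z hz => ?_)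
      simp [hz]
    rw [h2, eq_comm, neg_eq_zero] at h1
    rw [← setIntegral_eq_integral_of_forall_compl_eq_zero (s := D), ← h1]
    · exact integral_congr_ae (Filter.Eventually.of_forall fun z => by simp [mul_comm])
    · intro z hz
      have : g z = 0 := image_eq_zero_of_notMem_tsupport fun h => hz (hgs h)
      simp [this]
  have hfj' : f j =ᵐ[weightedMeasure D φ] 0 :=
    (withDensity_absolutelyContinuous _ _).ae_le ((ae_restrict_iff' hD.measurableSet).2 hfj)
  exact Lp.ext (((hf j).trans hfj').trans (Lp.coeFn_zero _ _ _).symm)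

/-- `H₁ = L²(D, φ)^{⊕p}`, the domain of `T₁` and `T₂`. -/
abbrev L2Tuple (p : ℕ) (D : Set (Fin n → ℂ)) (φ : (Fin n → ℂ) → ℝ) : Type :=
  PiLp 2 fun _ : Fin p => L2 D φ

/-- `H₃ = L²_{(0,1)}(D, φ)^{⊕p}`. -/
abbrev L2FormTuple (p : ℕ) (D : Set (Fin n → ℂ)) (φ : (Fin n → ℂ) → ℝ) : Type :=
  PiLp 2 fun _ : Fin p => L2Form D φ

/-- `T₂ h = (∂̄h₁, …, ∂̄h_p)`, defined when all `h_i` are in the domain of `∂̄`. -/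
noncomputable def T₂ (p : ℕ) (D : Set (Fin n → ℂ)) (φ : (Fin n → ℂ) → ℝ) :
    L2Tuple p D φ →ₗ.[ℂ] L2FormTuple p D φ where
  domain :=
    { carrier := {h | ∀ i, h i ∈ (dbar D φ).domain}
      zero_mem' := fun _ => (dbar D φ).domain.zero_mem
      add_mem' := fun h h' i => (dbar D φ).domain.add_mem (h i) (h' i)
      smul_mem' := fun c _ h i => (dbar D φ).domain.smul_mem c (h i) }
  toFun :=
    { toFun := fun h => WithLp.toLp 2 fun i => dbar D φ ⟨h.1 i, h.2 i⟩
      map_add' := fun h h' => by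
        ext i : 1
        exact (dbar D φ).map_add ⟨h.1 i, h.2 i⟩ ⟨h'.1 i, h'.2 i⟩
      map_smul' := fun c h => by
        ext i : 1
        exact (dbar D φ).map_smul c ⟨h.1 i, h.2 i⟩ }

/-- The function `φ(z) = a‖z‖²` on `ℂⁿ`, with the Euclidean norm. -/
noncomputable def quadraticWeight (n : ℕ) (a : ℝ) (z : Fin n → ℂ) : ℝ :=
  a * ∑ i, ‖z i‖ ^ 2

/-- `T₁ h = ∑ g_i h_i`, a bounded operator `L²(D, φ)^{⊕p} → L²(D, φ)` for bounded `g_i`. -/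
noncomputable def T₁ (D : Set (Fin n → ℂ)) (φ : (Fin n → ℂ) → ℝ) (g : Fin p → (Fin n → ℂ) → ℂ)
    (hg : ∀ i, MemLp (g i) ∞ (weightedMeasure D φ)) : L2Tuple p D φ →L[ℂ] L2 D φ :=
  ∑ i, ((ContinuousLinearMap.mul ℂ ℂ).holderL (weightedMeasure D φ) ∞ 2 2 (hg i).toLp).comp
    (PiLp.proj 2 (fun _ : Fin p => L2 D φ) i)

/-- Bounded holomorphic tuples have essentially bounded components. -/
theorem memLp_top_of_bounded {D : Set (Fin n → ℂ)} (hD : IsOpen D) (φ : (Fin n → ℂ) → ℝ)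
    {g : Fin p → (Fin n → ℂ) → ℂ} (hg : ∀ i, DifferentiableOn ℂ (g i) D)
    (hb : BddAbove ((fun z => ∑ i, ‖g i z‖ ^ 2) '' D)) (i : Fin p) :
    MemLp (g i) ∞ (weightedMeasure D φ) := by
  obtain ⟨M, hM⟩ := hb
  have hac : weightedMeasure D φ ≪ volume.restrict D := withDensity_absolutelyContinuous _ _
  refine memLp_top_of_bound
    (((hg i).continuousOn.aestronglyMeasurable hD.measurableSet).mono_ac hac) (√M) ?_
  refine hac.ae_le ((ae_restrict_iff' hD.measurableSet).2 (Filter.Eventually.of_forall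
    fun z hz => Real.le_sqrt_of_sq_le ?_))
  exact (Finset.single_le_sum (f := fun i => ‖g i z‖ ^ 2) (fun _ _ => by positivity)
    (Finset.mem_univ i)).trans (hM (Set.mem_image_of_mem _ hz))

end L2Division

open L2Division MeasureTheory

/-!
Let `|g|² ≥ m > 0` and `|∂g|² ≤ M`, and let `u` be holomorphic. The tuple `T₁* u = (ḡ₁ u, …, ḡₚ u)`
has norm at least `√m ‖u‖`, and only the derivatives of the `ḡᵢ` enter `∂̄(T₁* u)`, so
`‖∂̄(T₁* u)‖² ≤ M ‖u‖²`. As the curvature of `a‖z‖²` is `a` times the identity, `L²`-optimality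
yields `s` with `∂̄s = ∂̄(T₁* u)` and `‖s‖² ≤ (M / a) ‖u‖²`. Since `T₁* u - s` lies in `Ker T₂`, the
projection of `T₁* u` to `Ker T₂` has squared norm at least `(m - M / a) ‖u‖²`.

Adding `T₂* v`, which is orthogonal to `Ker T₂`, does not change this projection: this is the
estimate for `T₁* u + T₂* v`. On the other hand the lower bound says that the adjoint of
`T₁ : Ker T₂ → Ker ∂̄` is bounded below, so this operator is onto, and by Weyl's lemma the elements
of both kernels are represented by holomorphic functions.
-/

namespace L2Division

open scoped ENNReal ContDiff ComplexOrder Convolution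

variable {n p : ℕ}

section Wirtinger

variable {D : Set (Fin n → ℂ)} {F G χ u : (Fin n → ℂ) → ℂ} {f : Fin n → (Fin n → ℂ) → ℂ}
  {z : Fin n → ℂ} {j : Fin n}

theorem dzbar_fun_mul (hF : DifferentiableAt ℝ F z) (hG : DifferentiableAt ℝ G z) :
    dzbar j (fun w => F w * G w) z = dzbar j F z * G z + F z * dzbar j G z := by
  simp only [dzbar, fderiv_fun_mul hF hG, add_apply, smul_apply, smul_eq_mul]
  ring

theorem dzbar_fun_sum {ι : Type*} {s : Finset ι} {H : ι → (Fin n → ℂ) → ℂ}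
    (hH : ∀ i ∈ s, DifferentiableAt ℝ (H i) z) :
    dzbar j (fun w => ∑ i ∈ s, H i w) z = ∑ i ∈ s, dzbar j (H i) z := by
  simp only [dzbar, fderiv_fun_sum hH, sum_apply, Finset.mul_sum, ← Finset.sum_add_distrib]

theorem dzbar_star (j : Fin n) (F : (Fin n → ℂ) → ℂ) (z : Fin n → ℂ) :
    dzbar j (fun w => star (F w)) z = star (dz j F z) := by
  have h : fderiv ℝ (fun w => star (F w)) z = (Complex.conjCLE : ℂ →L[ℝ] ℂ).comp (fderiv ℝ F z) :=
    Complex.conjCLE.comp_fderiv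
  simp only [dzbar, dz, h]
  simp

theorem dzbar_eq_zero (hF : DifferentiableAt ℂ F z) : dzbar j F z = 0 := by
  have h_single : (Pi.single j Complex.I : Fin n → ℂ) = Complex.I • Pi.single j (1 : ℂ) := by
    simp [← Pi.single_smul]
  rw [dzbar, hF.fderiv_restrictScalars ℝ, h_single]
  simp only [ContinuousLinearMap.coe_restrictScalars', map_smul, smul_eq_mul, ← mul_assoc,
    Complex.I_mul_I]
  ring

theorem differentiableAt_of_dzbar_eq_zero (hF : DifferentiableAt ℝ F z)
    (h : ∀ j, dzbar j F z = 0) : DifferentiableAt ℂ F z := by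
  have h_I : ∀ j, fderiv ℝ F z (Pi.single j Complex.I)
      = Complex.I * fderiv ℝ F z (Pi.single j 1) := fun j => by
    have hj : _ + _ = (0 : ℂ) := (mul_eq_zero.1 (h j)).resolve_left (by norm_num)
    linear_combination (-Complex.I) * hj
      + fderiv ℝ F z (Pi.single j Complex.I) * Complex.I_mul_I
  rw [differentiableAt_iff_restrictScalars ℝ hF]
  refine ⟨∑ j, (ContinuousLinearMap.proj (R := ℂ) (φ := fun _ : Fin n => ℂ) j).smulRight
    (fderiv ℝ F z (Pi.single j 1)), ?_⟩
  refine ContinuousLinearMap.coe_injective (LinearMap.pi_ext' fun j =>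
    Complex.basisOneI.ext fun i => ?_)
  fin_cases i <;> simp [Pi.single_apply, h_I]

theorem contDiff_dzbar (hF : ContDiff ℝ ∞ F) (j : Fin n) : ContDiff ℝ ∞ (dzbar j F) := by
  have : ContDiff ℝ ∞ (fderiv ℝ F) := hF.fderiv_right (by simp)
  unfold dzbar
  fun_prop

theorem continuousOn_dzbar (hD : IsOpen D) (hF : ContDiffOn ℝ ∞ F D) (j : Fin n) :
    ContinuousOn (dzbar j F) D := by
  have : ContinuousOn (fderiv ℝ F) D := hF.continuousOn_fderiv_of_isOpen hD (by simp)
  unfold dzbar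
  fun_prop

theorem fderiv_dzbar_apply (hF : DifferentiableAt ℝ (fderiv ℝ F) z) (v : Fin n → ℂ) :
    fderiv ℝ (dzbar j F) z v = (1 / 2 : ℂ) * (fderiv ℝ (fderiv ℝ F) z v (Pi.single j 1)
      + Complex.I * fderiv ℝ (fderiv ℝ F) z v (Pi.single j Complex.I)) := by
  have hd : ∀ w, DifferentiableAt ℝ (fun x => fderiv ℝ F x w) z := fun w => by fun_prop
  unfold dzbar
  rw [fderiv_const_mul (by fun_prop), fderiv_fun_add (hd _) (by fun_prop), fderiv_const_mul (hd _)]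
  simp [fderiv_clm_apply hF (differentiableAt_const _), mul_add]

theorem dzbar_comm (hF : ContDiff ℝ ∞ F) (j k : Fin n) (z : Fin n → ℂ) :
    dzbar j (dzbar k F) z = dzbar k (dzbar j F) z := by
  have hd : DifferentiableAt ℝ (fderiv ℝ F) z :=
    ((hF.fderiv_right (m := ∞) (by simp)).differentiable (by simp)) z
  have hs : IsSymmSndFDerivAt ℝ F z := hF.contDiffAt.isSymmSndFDerivAt (by
    rw [minSmoothness_of_isRCLikeNormedField]; exact WithTop.coe_le_coe.2 (le_top : (2 : ℕ∞) ≤ ⊤))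
  rw [dzbar, dzbar]
  simp only [fderiv_dzbar_apply hd, hs.eq (Pi.single j _)]
  ring

theorem dzbar_comp_sub (j : Fin n) (z s : Fin n → ℂ) :
    dzbar j (fun s => F (z - s)) s = -dzbar j F (z - s) := by
  have h : fderiv ℝ (fun s => F (z - s)) s = -fderiv ℝ F (z - s) := by
    have h_neg := (ContinuousLinearEquiv.neg ℝ (M := Fin n → ℂ)).comp_right_fderiv
      (f := fun s => F (z + s)) (x := s)
    simp only [fderiv_comp_add_left, ContinuousLinearEquiv.coe_neg] at h_neg
    simp only [sub_eq_add_neg]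
    refine h_neg.trans ?_
    ext v
    simp
  simp only [dzbar, h, neg_apply]
  ring

theorem isTestFunction_ofReal {κ : (Fin n → ℂ) → ℝ} (hκ : ContDiff ℝ ∞ κ)
    (hc : HasCompactSupport κ) (hs : tsupport κ ⊆ D) : IsTestFunction D fun z => (κ z : ℂ) := by
  have hsub : tsupport (fun z => (κ z : ℂ)) ⊆ tsupport κ :=
    closure_mono fun z hz => by simpa using hz
  exact ⟨Complex.ofRealCLM.contDiff.comp hκ, hc.of_isClosed_subset (isClosed_tsupport _) hsub,
    hsub.trans hs⟩

theorem IsTestFunction.dzbar (h : IsTestFunction D χ) (j : Fin n) :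
    IsTestFunction D (dzbar j χ) := by
  have hs : tsupport (L2Division.dzbar j χ) ⊆ tsupport χ :=
    closure_minimal (support_dzbar j) (isClosed_tsupport _)
  exact ⟨contDiff_dzbar h.1 j, h.2.1.of_isClosed_subset (isClosed_tsupport _) hs, hs.trans h.2.2⟩

theorem IsTestFunction.contDiffOn_mul (hD : IsOpen D) (h : IsTestFunction D χ)
    (hG : ContDiffOn ℝ ∞ G D) : IsTestFunction D fun z => G z * χ z := by
  have hs : tsupport (fun z => G z * χ z) ⊆ tsupport χ :=
    closure_mono (Function.support_mul_subset_right G χ)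
  refine ⟨contDiff_iff_contDiffAt.2 fun z => ?_, h.2.1.mul_left, hs.trans h.2.2⟩
  by_cases hz : z ∈ D
  · exact (hG.contDiffAt (hD.mem_nhds hz)).mul h.1.contDiffAt
  · have hz' : z ∉ tsupport fun z => G z * χ z := fun hh => hz (h.2.2 (hs hh))
    exact contDiffAt_const.congr_of_eventuallyEq (notMem_tsupport_iff_eventuallyEq.1 hz')

theorem IsTestFunction.integrable_fderiv_apply (h : IsTestFunction D χ) (v : Fin n → ℂ) :
    Integrable (fun z => fderiv ℝ χ z v) :=
  ((h.1.continuous_fderiv (by simp)).clm_apply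
    continuous_const).integrable_of_hasCompactSupport (h.2.1.fderiv_apply ℝ v)

theorem IsTestFunction.integral_fderiv_apply (h : IsTestFunction D χ) (v : Fin n → ℂ) :
    ∫ z, fderiv ℝ χ z v = 0 := by
  simpa using integral_mul_fderiv_eq_neg_fderiv_mul_of_integrable (μ := volume) (𝕜 := ℂ)
    (f := fun _ : Fin n → ℂ => (1 : ℂ)) (g := χ) (v := v) (by simp)
    (by simpa using h.integrable_fderiv_apply v)
    (by simpa using h.1.continuous.integrable_of_hasCompactSupport h.2.1)
    (fun _ _ => by fun_prop) (fun x _ => h.1.contDiffAt.differentiableAt (by simp))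

theorem IsTestFunction.integral_dzbar (h : IsTestFunction D χ) (j : Fin n) :
    ∫ z in D, L2Division.dzbar j χ z = 0 := by
  rw [setIntegral_eq_integral_of_forall_compl_eq_zero
    fun z hz => Function.notMem_support.1 fun hh => hz (h.2.2 (support_dzbar j hh))]
  unfold L2Division.dzbar
  rw [integral_const_mul, integral_add (h.integrable_fderiv_apply _)
    ((h.integrable_fderiv_apply _).const_mul _), integral_const_mul,
    h.integral_fderiv_apply, h.integral_fderiv_apply]
  simp

theorem IsWeakDbar.mono {U : Set (Fin n → ℂ)} (h : IsWeakDbar D u f) (hU : U ⊆ D) :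
    IsWeakDbar U u f := by
  have h_ext : ∀ V : Set (Fin n → ℂ), ∀ w v χ : (Fin n → ℂ) → ℂ, tsupport χ ⊆ V →
      Function.support v ⊆ tsupport χ → ∫ z in V, w z * v z = ∫ z, w z * v z :=
    fun V w v χ hχ hv => setIntegral_eq_integral_of_forall_compl_eq_zero fun z hz => by
      rw [Function.notMem_support.1 fun hh => hz (hχ (hv hh)), mul_zero]
  refine ⟨h.1.mono_set hU, fun j => (h.2.1 j).mono_set hU, fun χ hχ j => ?_⟩
  have hD := h.2.2 χ ⟨hχ.1, hχ.2.1, hχ.2.2.trans hU⟩ j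
  rwa [h_ext D _ _ χ (hχ.2.2.trans hU) (support_dzbar j),
    h_ext D _ _ χ (hχ.2.2.trans hU) subset_closure, ← h_ext U _ _ χ hχ.2.2 (support_dzbar j),
    ← h_ext U _ _ χ hχ.2.2 subset_closure] at hD

theorem IsWeakDbar.congr_ae {v : (Fin n → ℂ) → ℂ} {g : Fin n → (Fin n → ℂ) → ℂ}
    (h : IsWeakDbar D u f) (hu : u =ᵐ[volume.restrict D] v)
    (hf : ∀ j, f j =ᵐ[volume.restrict D] g j) : IsWeakDbar D v g := by
  refine ⟨h.1.congr hu, fun j => (h.2.1 j).congr (hf j), fun χ hχ j => ?_⟩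
  have hu' : ∫ z in D, v z * L2Division.dzbar j χ z = ∫ z in D, u z * L2Division.dzbar j χ z :=
    integral_congr_ae (hu.mono fun z hz => by simp only [hz])
  have hf' : ∫ z in D, g j z * χ z = ∫ z in D, f j z * χ z :=
    integral_congr_ae ((hf j).mono fun z hz => by simp only [hz])
  rw [hu', hf', h.2.2 χ hχ j]

theorem IsWeakDbar.isDbarClosed (h : IsWeakDbar D u f) : IsDbarClosed D f := by
  refine ⟨h.2.1, fun χ hχ j k => ?_⟩
  rw [← neg_inj, ← h.2.2 _ (hχ.dzbar k) j, ← h.2.2 _ (hχ.dzbar j) k]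
  simp only [dzbar_comm hχ.1 j k]

theorem IsWeakDbar.mul_contDiffOn (hD : IsOpen D) (h : IsWeakDbar D u f)
    (hG : ContDiffOn ℝ ∞ G D) :
    IsWeakDbar D (fun z => u z * G z) fun j z => f j z * G z + u z * dzbar j G z := by
  have hloc : ∀ {w v : (Fin n → ℂ) → ℂ}, LocallyIntegrableOn w D → ContinuousOn v D →
      LocallyIntegrableOn (fun z => w z * v z) D :=
    fun hw hv => hw.mul_continuousOn hv hD.isLocallyClosed
  have hfG := fun j => hloc (h.2.1 j) hG.continuousOn
  have huG := fun j => hloc h.1 (continuousOn_dzbar hD hG j)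
  refine ⟨hloc h.1 hG.continuousOn, fun j => (hfG j).add (huG j), fun χ hχ j => ?_⟩
  have hi : ∀ {w : (Fin n → ℂ) → ℂ}, LocallyIntegrableOn w D →
      Integrable (fun z => w z * χ z) (volume.restrict D) :=
    fun hw => integrable_mul_of_support hχ hw hχ.1.continuous subset_closure
  have h_leibniz : ∫ z in D, u z * L2Division.dzbar j (fun w => G w * χ w) z
      = ∫ z in D, (u z * L2Division.dzbar j G z * χ z
        + u z * G z * L2Division.dzbar j χ z) := by
    refine setIntegral_congr_fun hD.measurableSet fun z hz => ?_
    have hd : DifferentiableAt ℝ G z :=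
      (hG.contDiffAt (hD.mem_nhds hz)).differentiableAt (by simp)
    simp only [dzbar_fun_mul hd (hχ.1.contDiffAt.differentiableAt (by simp))]
    ring
  rw [h.2.2 _ (hχ.contDiffOn_mul hD hG) j, integral_add (hi (huG j))
    (integrable_mul_of_support hχ (hloc h.1 hG.continuousOn) (hχ.continuous_dzbar j)
      (support_dzbar j))] at h_leibniz
  simp only [add_mul]
  rw [integral_add (hi (hfG j)) (hi (huG j))]
  simp only [mul_assoc] at h_leibniz ⊢
  linear_combination -h_leibniz

theorem isWeakDbar_of_contDiffOn (hD : IsOpen D) (hG : ContDiffOn ℝ ∞ G D) :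
    IsWeakDbar D G fun j => dzbar j G := by
  have h_one : IsWeakDbar D (fun _ => 1) 0 :=
    ⟨(locallyIntegrable_const _).locallyIntegrableOn _, fun _ => locallyIntegrableOn_zero,
      fun χ hχ j => by simpa using hχ.integral_dzbar j⟩
  simpa using h_one.mul_contDiffOn hD hG

end Wirtinger

section CircleAverage

open Real in
theorem integral_circleAverage_smul {E V : Type*} [NormedAddCommGroup E] [NormedSpace ℂ E]
    [SecondCountableTopology E] [MeasurableSpace E] [BorelSpace E] [NormedAddCommGroup V]
    [NormedSpace ℝ V] [CompleteSpace V] {μ : Measure E} [SFinite μ]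
    [SMulInvariantMeasure Circle E μ] {G : E → V} (hG : Continuous G) (hi : Integrable G μ) :
    ∫ t, circleAverage (fun ζ => G (ζ • t)) 0 1 ∂μ = ∫ t, G t ∂μ := by
  have h_circle : ∀ θ (t : E), G (circleMap 0 1 θ • t) = G (Circle.exp θ • t) := by
    simp [circleMap, Circle.smul_def]
  have h_invariant : ∀ θ, ∫ t, G (circleMap 0 1 θ • t) ∂μ = ∫ t, G t ∂μ := fun θ => by
    simp only [h_circle, integral_smul_eq_self]
  have h_integrable : Integrable (Function.uncurry fun (θ : ℝ) t => G (circleMap 0 1 θ • t))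
      ((volume.restrict (Set.Ioc 0 (2 * π))).prod μ) := by
    have h_cont : Continuous (Function.uncurry fun (θ : ℝ) t => G (circleMap 0 1 θ • t)) := by
      unfold Function.uncurry
      fun_prop
    refine (integrable_prod_iff h_cont.aestronglyMeasurable).2 ⟨.of_forall fun θ => ?_, ?_⟩
    · simp only [Function.uncurry_apply_pair, h_circle]
      exact (measurePreserving_smul (Circle.exp θ) μ).integrable_comp_of_integrable hi
    · simp only [Function.uncurry_apply_pair, h_circle,
        integral_smul_eq_self (μ := μ) fun t => ‖G t‖]
      exact integrable_const _
  simp only [circleAverage_def, intervalIntegral.integral_of_le two_pi_pos.le]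
  rw [integral_smul, ← integral_integral_swap h_integrable]
  simp only [h_invariant, integral_const, measureReal_restrict_apply_univ, volume_real_Ioc]
  rw [sub_zero, max_eq_left two_pi_pos.le, inv_smul_smul₀ two_pi_pos.ne']

end CircleAverage

section MeanValue

variable {ρ : (Fin n → ℂ) → ℝ} {F : (Fin n → ℂ) → ℂ} {z : Fin n → ℂ} {ε : ℝ}

instance : SMulInvariantMeasure Circle (Fin n → ℂ) volume where
  measure_preimage_smul c _ hs :=
    (volume_preserving_pi fun _ : Fin n => (rotation c).measurePreserving).measure_preimage
      hs.nullMeasurableSet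

/-- A mollifier `ρ` on `ℂⁿ` supported in the polydisc of radius `ε` that is invariant under
`w ↦ e^{iθ} w`; by the mean value property on discs, convolution with it fixes holomorphic
functions. No positivity is required. -/
structure IsCircleMollifier (ρ : (Fin n → ℂ) → ℝ) (ε : ℝ) : Prop where
  contDiff : ContDiff ℝ ∞ ρ
  tsupport_subset : tsupport ρ ⊆ Metric.closedBall 0 ε
  circle_smul (c : Circle) (w : Fin n → ℂ) : ρ (c • w) = ρ w
  integral_eq_one : ∫ w, ρ w = 1

theorem IsCircleMollifier.hasCompactSupport (hρ : IsCircleMollifier ρ ε) : HasCompactSupport ρ :=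
  (isCompact_closedBall 0 ε).of_isClosed_subset (isClosed_tsupport _) hρ.tsupport_subset

theorem IsCircleMollifier.apply_eq_zero (hρ : IsCircleMollifier ρ ε)
    (hz : z ∉ Metric.closedBall 0 ε) : ρ z = 0 :=
  image_eq_zero_of_notMem_tsupport fun h => hz (hρ.tsupport_subset h)

theorem norm_le_of_sum_norm_sq_le (hε : 0 ≤ ε) (hz : ∑ i, ‖z i‖ ^ 2 ≤ ε ^ 2) : ‖z‖ ≤ ε :=
  (pi_norm_le_iff_of_nonneg hε).2 fun i => le_of_sq_le_sq
    ((Finset.single_le_sum (f := fun i => ‖z i‖ ^ 2) (fun _ _ => by positivity)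
      (Finset.mem_univ i)).trans hz) hε

theorem exists_isCircleMollifier (n : ℕ) (hε : 0 < ε) :
    ∃ ρ : (Fin n → ℂ) → ℝ, IsCircleMollifier ρ ε := by
  let b : ContDiffBump (0 : ℝ) := ⟨ε ^ 2 / 2, ε ^ 2, by positivity, half_lt_self (by positivity)⟩
  let κ : (Fin n → ℂ) → ℝ := fun w => b (∑ i, ‖w i‖ ^ 2)
  have hκ : ContDiff ℝ ∞ κ :=
    b.contDiff.comp (ContDiff.sum fun i _ => (contDiff_apply ℝ ℂ i).norm_sq ℝ)
  have hs : tsupport κ ⊆ Metric.closedBall 0 ε := by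
    refine closure_minimal (fun w hw => ?_) Metric.isClosed_closedBall
    have hball : ∑ i, ‖w i‖ ^ 2 ∈ Metric.ball (0 : ℝ) (ε ^ 2) := b.support_eq ▸ hw
    rw [mem_ball_zero_iff] at hball
    exact mem_closedBall_zero_iff.2
      (norm_le_of_sum_norm_sq_le hε.le ((le_abs_self _).trans hball.le))
  have hpos : 0 < ∫ w, κ w := by
    refine hκ.continuous.integral_pos_of_hasCompactSupport_nonneg_nonzero
      ((isCompact_closedBall 0 ε).of_isClosed_subset (isClosed_tsupport _) hs)
      (fun w => b.nonneg) (x := 0) ?_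
    simp [κ, b.one_of_mem_closedBall (Metric.mem_closedBall_self b.rIn_pos.le)]
  exact ⟨fun w => (∫ w, κ w)⁻¹ * κ w,
    { contDiff := contDiff_const.mul hκ
      tsupport_subset := (closure_mono (Function.support_mul_subset_right _ κ)).trans hs
      circle_smul := fun c w => by simp [κ, Circle.smul_def, Circle.norm_coe]
      integral_eq_one := by rw [integral_const_mul, inv_mul_cancel₀ hpos.ne'] }⟩

theorem IsCircleMollifier.circleAverage_smul (hρ : IsCircleMollifier ρ ε)
    (hF : ∀ w ∈ Metric.closedBall z ε, DifferentiableAt ℂ F w) (t : Fin n → ℂ) :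
    Real.circleAverage (fun ζ => ρ (ζ • t) • F (z - ζ • t)) 0 1 = ρ t • F z := by
  have h_inv : Set.EqOn (fun ζ : ℂ => ρ (ζ • t) • F (z - ζ • t)) (fun ζ => ρ t • F (z - ζ • t))
      (Metric.sphere 0 |1|) := fun ζ hζ => by
    have hρζ : ρ (ζ • t) = ρ t :=
      hρ.circle_smul ⟨ζ, by simpa [Submonoid.unitSphere] using hζ⟩ t
    simp only [hρζ]
  rw [Real.circleAverage_congr_sphere h_inv, Real.circleAverage_fun_smul]
  by_cases ht : t ∈ Metric.closedBall 0 ε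
  · have hd : ∀ ζ ∈ Metric.closedBall (0 : ℂ) |1|,
        DifferentiableAt ℂ (fun ζ : ℂ => F (z - ζ • t)) ζ := fun ζ hζ => by
      rw [mem_closedBall_zero_iff] at hζ ht
      have hmem : z - ζ • t ∈ Metric.closedBall z ε := by
        rw [Metric.mem_closedBall, dist_self_sub_left, norm_smul]
        exact (mul_le_of_le_one_left (norm_nonneg t) (by simpa using hζ)).trans ht
      exact (hF _ hmem).comp (f := fun ζ : ℂ => z - ζ • t) ζ (by fun_prop)
    rw [circleAverage_of_differentiable_on_off_countable Set.countable_empty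
      (fun ζ hζ => (hd ζ hζ).continuousAt.continuousWithinAt)
      (fun ζ hζ => hd ζ (Metric.ball_subset_closedBall hζ.1)), zero_smul, sub_zero]
  · simp [hρ.apply_eq_zero ht]

theorem IsCircleMollifier.continuous_smul_comp_sub (hρ : IsCircleMollifier ρ ε)
    (hF : ∀ w ∈ Metric.closedBall z ε, ContinuousAt F w) :
    Continuous fun t => ρ t • F (z - t) := by
  refine continuous_iff_continuousAt.2 fun t => ?_
  by_cases ht : t ∈ tsupport ρ
  · have hmem : z - t ∈ Metric.closedBall z ε := by
      simpa [Metric.mem_closedBall, dist_self_sub_left] using hρ.tsupport_subset ht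
    exact hρ.contDiff.continuous.continuousAt.smul
      ((hF _ hmem).comp (f := fun t => z - t) (by fun_prop))
  · have h0 : (fun t => ρ t • F (z - t)) =ᶠ[nhds t] fun _ => 0 :=
      (notMem_tsupport_iff_eventuallyEq.1 ht).mono fun s hs => by simp [hs]
    exact continuousAt_const.congr h0.symm

theorem IsCircleMollifier.integral_smul_comp_sub (hρ : IsCircleMollifier ρ ε)
    (hF : ∀ w ∈ Metric.closedBall z ε, DifferentiableAt ℂ F w) :
    ∫ t, ρ t • F (z - t) = F z := by
  have hG := hρ.continuous_smul_comp_sub fun w hw => (hF w hw).continuousAt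
  rw [← integral_circleAverage_smul hG
    (hG.integrable_of_hasCompactSupport hρ.hasCompactSupport.smul_right)]
  simp only [hρ.circleAverage_smul hF]
  rw [integral_smul_const, hρ.integral_eq_one, one_smul]

end MeanValue

section Gluing

theorem ae_restrict_of_locally {E : Type*} [TopologicalSpace E] [SecondCountableTopology E]
    [MeasurableSpace E] {μ : Measure E} {D : Set E} {P : E → Prop}
    (hP : ∀ z₀ ∈ D, ∃ U ∈ nhds z₀, ∀ᵐ z ∂μ, z ∈ U → P z) : ∀ᵐ z ∂μ, z ∈ D → P z := by
  rw [ae_iff]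
  refine measure_null_of_locally_null _ fun z₀ hz₀ => ?_
  obtain ⟨U, hU, hPU⟩ := hP z₀ (Classical.not_imp.1 hz₀).1
  refine ⟨_, Filter.inter_mem self_mem_nhdsWithin (mem_nhdsWithin_of_mem_nhds hU), ?_⟩
  exact measure_mono_null (fun z hz => Classical.not_imp.2 ⟨hz.2, (Classical.not_imp.1 hz.1).2⟩)
    (ae_iff.1 hPU)

variable {𝕜 E V : Type*} [NontriviallyNormedField 𝕜] [NormedAddCommGroup E] [NormedSpace 𝕜 E]
  [SecondCountableTopology E] [MeasurableSpace E] [BorelSpace E] {μ : Measure E}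
  [μ.IsOpenPosMeasure] [NormedAddCommGroup V] [NormedSpace 𝕜 V] {D : Set E} {h : E → V}

theorem exists_differentiableOn_of_locally (hD : IsOpen D)
    (hloc : ∀ z₀ ∈ D, ∃ U : Set E, ∃ H : E → V, IsOpen U ∧ z₀ ∈ U ∧ DifferentiableOn 𝕜 H U ∧
      ∀ᵐ z ∂μ, z ∈ U → h z = H z) :
    ∃ H : E → V, DifferentiableOn 𝕜 H D ∧ ∀ᵐ z ∂μ, z ∈ D → h z = H z := by
  choose! U H hU hmem hH hae using hloc
  have h_glue : ∀ z₀ ∈ D, ∀ z ∈ U z₀ ∩ D, H z z = H z₀ z := fun z₀ hz₀ z hz => by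
    have hUU : IsOpen (U z ∩ U z₀) := (hU z hz.2).inter (hU z₀ hz₀)
    refine Measure.eqOn_open_of_ae_eq (μ := μ) ?_ hUU
      ((hH z hz.2).continuousOn.mono Set.inter_subset_left)
      ((hH z₀ hz₀).continuousOn.mono Set.inter_subset_right) ⟨hmem z hz.2, hz.1⟩
    rw [Filter.EventuallyEq, ae_restrict_iff' hUU.measurableSet]
    filter_upwards [hae z hz.2, hae z₀ hz₀] with w hw hw₀ hmemw
    rw [← hw hmemw.1, ← hw₀ hmemw.2]
  have hnhds : ∀ z₀ ∈ D, U z₀ ∩ D ∈ nhds z₀ := fun z₀ hz₀ =>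
    ((hU z₀ hz₀).inter hD).mem_nhds ⟨hmem z₀ hz₀, hz₀⟩
  refine ⟨fun z => H z z, fun z₀ hz₀ => ?_, ae_restrict_of_locally fun z₀ hz₀ =>
    ⟨_, hnhds z₀ hz₀, (hae z₀ hz₀).mono fun z hz hzU => ?_⟩⟩
  · exact (((hH z₀ hz₀).differentiableAt ((hU z₀ hz₀).mem_nhds
      (hmem z₀ hz₀))).congr_of_eventuallyEq (Set.EqOn.eventuallyEq_of_mem
        (h_glue z₀ hz₀) (hnhds z₀ hz₀))).differentiableWithinAt
  · exact (hz hzU.1).trans (h_glue z₀ hz₀ z hzU).symm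

end Gluing

section Convolution

open ContinuousLinearMap (lsmul)

theorem convolution_lsmul_left_comm {E V : Type*} [NormedAddCommGroup E] [LocallyCompactSpace E]
    [SecondCountableTopology E] [MeasurableSpace E] [BorelSpace E] {μ : Measure E}
    [μ.IsAddHaarMeasure] [NormedAddCommGroup V] [NormedSpace ℝ V] [CompleteSpace V]
    {ρ η : E → ℝ} {h : E → V} (hρ : Continuous ρ) (hρs : HasCompactSupport ρ) (hη : Continuous η)
    (hηs : HasCompactSupport η) (hh : LocallyIntegrable h μ) :
    ρ ⋆[lsmul ℝ ℝ, μ] (η ⋆[lsmul ℝ ℝ, μ] h) = η ⋆[lsmul ℝ ℝ, μ] (ρ ⋆[lsmul ℝ ℝ, μ] h) := by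
  have h_norm : LocallyIntegrable (fun x => ‖h x‖) μ :=
    locallyIntegrableOn_univ.1 (locallyIntegrableOn_univ.2 hh).norm
  have h_assoc : ∀ {ρ η : E → ℝ}, Continuous ρ → HasCompactSupport ρ → Continuous η →
      HasCompactSupport η → (ρ ⋆[ContinuousLinearMap.mul ℝ ℝ, μ] η) ⋆[lsmul ℝ ℝ, μ] h
        = ρ ⋆[lsmul ℝ ℝ, μ] (η ⋆[lsmul ℝ ℝ, μ] h) := fun hρ hρs hη hηs => by
    ext x
    refine convolution_assoc _ _ _ _ (fun x y z => mul_smul x y z) hρ.aestronglyMeasurable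
      hη.aestronglyMeasurable hh.aestronglyMeasurable
      (Filter.Eventually.of_forall fun y => ?_) (Filter.Eventually.of_forall fun y => ?_) ?_
    · exact hρs.convolutionExists_left _ hρ hη.locallyIntegrable y
    · exact hηs.norm.convolutionExists_left _ hη.norm h_norm y
    · exact hρs.norm.convolutionExists_left _ hρ.norm
        (hηs.norm.continuous_convolution_left _ hη.norm h_norm).locallyIntegrable x
  have h_comm : ρ ⋆[ContinuousLinearMap.mul ℝ ℝ, μ] η = η ⋆[ContinuousLinearMap.mul ℝ ℝ, μ] ρ := by
    rw [← convolution_flip]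
    congr 1
    ext
    simp
  rw [← h_assoc hρ hρs hη hηs, ← h_assoc hη hηs hρ hρs, h_comm]

variable {U D : Set (Fin n → ℂ)} {F h : (Fin n → ℂ) → ℂ} {ρ η : (Fin n → ℂ) → ℝ}
  {z z₀ : Fin n → ℂ} {ε δ r : ℝ}

theorem IsCircleMollifier.convolution_eq (hρ : IsCircleMollifier ρ ε)
    (hF : ∀ w ∈ Metric.closedBall z ε, DifferentiableAt ℂ F w) :
    (ρ ⋆[lsmul ℝ ℝ] F) z = F z :=
  hρ.integral_smul_comp_sub hF

theorem convolution_lsmul_congr {F' : (Fin n → ℂ) → ℂ} (hη : tsupport η ⊆ Metric.closedBall 0 r)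
    (hF : Set.EqOn F F' (Metric.closedBall z r)) :
    (η ⋆[lsmul ℝ ℝ] F) z = (η ⋆[lsmul ℝ ℝ] F') z := by
  refine integral_congr_ae (.of_forall fun t => ?_)
  by_cases ht : t ∈ tsupport η
  · have hmem : z - t ∈ Metric.closedBall z r := by
      simpa [Metric.mem_closedBall, dist_self_sub_left] using hη ht
    simp [hF hmem]
  · simp [image_eq_zero_of_notMem_tsupport ht]

theorem contDiffOn_of_differentiableOn (hD : IsOpen D) (hF : DifferentiableOn ℂ F D) :
    ContDiffOn ℝ ∞ F D := by
  intro z₀ hz₀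
  obtain ⟨R, hR, hRD⟩ := Metric.nhds_basis_closedBall.mem_iff.1 (hD.mem_nhds hz₀)
  obtain ⟨ρ, hρ⟩ := exists_isCircleMollifier n (half_pos hR)
  have hint : Integrable ((Metric.closedBall z₀ R).indicator F) :=
    (integrable_indicator_iff Metric.isClosed_closedBall.measurableSet).2
      ((hF.continuousOn.mono hRD).integrableOn_compact (isCompact_closedBall _ _))
  have h_smooth : ContDiff ℝ ∞ (ρ ⋆[lsmul ℝ ℝ] (Metric.closedBall z₀ R).indicator F) :=
    hρ.hasCompactSupport.contDiff_convolution_left _ hρ.contDiff hint.locallyIntegrable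
  refine (h_smooth.contDiffAt.congr_of_eventuallyEq ?_).contDiffWithinAt
  filter_upwards [Metric.ball_mem_nhds z₀ (half_pos hR)] with z hz
  have hsub : Metric.closedBall z (R / 2) ⊆ Metric.closedBall z₀ R :=
    Metric.closedBall_subset_closedBall' (by linarith [Metric.mem_ball.1 hz])
  rw [convolution_lsmul_congr hρ.tsupport_subset fun w hw => Set.indicator_of_mem (hsub hw) F,
    hρ.convolution_eq fun w hw => hF.differentiableAt (hD.mem_nhds (hRD (hsub hw)))]

theorem isWeakDbar_zero_of_differentiableOn (hD : IsOpen D) (hF : DifferentiableOn ℂ F D) :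
    IsWeakDbar D F 0 := by
  refine (isWeakDbar_of_contDiffOn hD (contDiffOn_of_differentiableOn hD hF)).congr_ae
    (ae_eq_refl _) fun j => ae_restrict_of_forall_mem hD.measurableSet fun z hz => ?_
  exact dzbar_eq_zero (hF.differentiableAt (hD.mem_nhds hz))

theorem convolutionExistsAt_fderiv (hη : ContDiff ℝ 1 η) (hηs : HasCompactSupport η)
    (hh : LocallyIntegrable h) (z : Fin n → ℂ) :
    ConvolutionExistsAt (fderiv ℝ η) h z ((lsmul ℝ ℝ (E := ℂ)).precompL (Fin n → ℂ)) volume :=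
  (hηs.fderiv ℝ).convolutionExists_left _ (hη.continuous_fderiv (by simp)) hh z

theorem integrable_fderiv_smul_comp_sub (hη : ContDiff ℝ 1 η) (hηs : HasCompactSupport η)
    (hh : LocallyIntegrable h) (z v : Fin n → ℂ) :
    Integrable fun t => fderiv ℝ η t v • h (z - t) :=
  (convolutionExistsAt_fderiv hη hηs hh z).integrable.apply_continuousLinearMap v

theorem fderiv_convolution_lsmul_apply (hη : ContDiff ℝ 1 η) (hηs : HasCompactSupport η)
    (hh : LocallyIntegrable h) (z v : Fin n → ℂ) :
    fderiv ℝ (η ⋆[lsmul ℝ ℝ] h) z v = ∫ t, fderiv ℝ η t v • h (z - t) := by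
  rw [(hηs.hasFDerivAt_convolution_left (lsmul ℝ ℝ (E := ℂ)) hη hh z).fderiv, convolution_def,
    ContinuousLinearMap.integral_apply (convolutionExistsAt_fderiv hη hηs hh z)]
  rfl

theorem dzbar_convolution_lsmul (hη : ContDiff ℝ 1 η) (hηs : HasCompactSupport η)
    (hh : LocallyIntegrable h) (j : Fin n) :
    dzbar j (η ⋆[lsmul ℝ ℝ] h) z = ∫ s, h s * dzbar j (fun t => (η t : ℂ)) (z - s) := by
  have h_int := integrable_fderiv_smul_comp_sub hη hηs hh z
  have h_ofReal : ∀ t v, fderiv ℝ (fun t => (η t : ℂ)) t v = (fderiv ℝ η t v : ℂ) := fun t v =>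
    congrArg (fun L => L v) (Complex.ofRealCLM.hasFDerivAt.comp t
      (hη.differentiable (by simp) t).hasFDerivAt).fderiv
  calc dzbar j (η ⋆[lsmul ℝ ℝ] h) z
      = ∫ t, h (z - t) * dzbar j (fun t => (η t : ℂ)) t := by
        rw [dzbar, fderiv_convolution_lsmul_apply hη hηs hh,
          fderiv_convolution_lsmul_apply hη hηs hh, ← integral_const_mul,
          ← integral_add (h_int _) ((h_int _).const_mul _), ← integral_const_mul]
        refine integral_congr_ae (.of_forall fun t => ?_)
        simp only [dzbar, h_ofReal, Complex.real_smul]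
        ring
    _ = ∫ s, h s * dzbar j (fun t => (η t : ℂ)) (z - s) := by
        rw [← integral_sub_left_eq_self _ volume z]
        simp only [sub_sub_cancel]

theorem isTestFunction_comp_sub (hη : ContDiff ℝ ∞ η) (hs : tsupport η ⊆ Metric.closedBall 0 r)
    (hz : Metric.closedBall z r ⊆ U) : IsTestFunction U fun s => (η (z - s) : ℂ) := by
  have hsub : tsupport (fun s => η (z - s)) ⊆ Metric.closedBall z r := by
    refine closure_minimal (fun s hs' => ?_) Metric.isClosed_closedBall
    have hmem := hs (subset_tsupport η hs')
    rwa [mem_closedBall_zero_iff, ← dist_eq_norm, dist_comm] at hmem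
  exact isTestFunction_ofReal (hη.comp (contDiff_const.sub contDiff_id))
    ((isCompact_closedBall z r).of_isClosed_subset (isClosed_tsupport _) hsub) (hsub.trans hz)

theorem IsWeakDbar.differentiableAt_convolution (hh : LocallyIntegrable h) (hU : IsWeakDbar U h 0)
    (hη : ContDiff ℝ ∞ η) (hs : tsupport η ⊆ Metric.closedBall 0 r)
    (hz : Metric.closedBall z r ⊆ U) : DifferentiableAt ℂ (η ⋆[lsmul ℝ ℝ] h) z := by
  have hηs : HasCompactSupport η :=
    (isCompact_closedBall 0 r).of_isClosed_subset (isClosed_tsupport _) hs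
  have hη1 : ContDiff ℝ 1 η := hη.of_le (by simp)
  refine differentiableAt_of_dzbar_eq_zero (hηs.hasFDerivAt_convolution_left
    (lsmul ℝ ℝ (E := ℂ)) hη1 hh z).differentiableAt fun j => ?_
  have h_test := isTestFunction_comp_sub hη hs hz
  have h_weak := hU.2.2 _ h_test j
  have h_sub := fun s => dzbar_comp_sub (F := fun t => (η t : ℂ)) j z s
  rw [setIntegral_eq_integral_of_forall_compl_eq_zero fun s hs => by
    rw [Function.notMem_support.1 fun h => hs (h_test.2.2 (support_dzbar j h)), mul_zero]] at h_weak
  simpa [h_sub, integral_neg, dzbar_convolution_lsmul hη1 hηs hh] using h_weak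

theorem IsCircleMollifier.convolution_convolution_eq (hρ : IsCircleMollifier ρ ε)
    (hh : LocallyIntegrable h) (hU : IsWeakDbar U h 0) (hη : ContDiff ℝ ∞ η)
    (hs : tsupport η ⊆ Metric.closedBall 0 δ) (hz : Metric.closedBall z (ε + δ) ⊆ U) :
    (η ⋆[lsmul ℝ ℝ] (ρ ⋆[lsmul ℝ ℝ] h)) z = (η ⋆[lsmul ℝ ℝ] h) z := by
  rw [convolution_lsmul_left_comm hη.continuous
    ((isCompact_closedBall 0 δ).of_isClosed_subset (isClosed_tsupport _) hs)
    hρ.contDiff.continuous hρ.hasCompactSupport hh]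
  refine hρ.convolution_eq fun w hw => hU.differentiableAt_convolution hh hη hs ?_
  refine (Metric.closedBall_subset_closedBall' ?_).trans hz
  linarith [Metric.mem_closedBall.1 hw]

theorem IsCircleMollifier.ae_eq_convolution (hρ : IsCircleMollifier ρ ε)
    (hh : LocallyIntegrable h) (hU : IsWeakDbar U h 0) (hδ : 0 < δ) :
    ∀ᵐ z, Metric.closedBall z (ε + δ) ⊆ U → h z = (ρ ⋆[lsmul ℝ ℝ] h) z := by
  let b : ℕ → ContDiffBump (0 : Fin n → ℂ) := fun k =>
    ⟨1 / (k + 1) / 2, 1 / (k + 1), by positivity, half_lt_self (by positivity)⟩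
  have hb : Filter.Tendsto (fun k => (b k).rOut) Filter.atTop (nhds 0) :=
    tendsto_one_div_add_atTop_nhds_zero_nat
  have hcont : Continuous (ρ ⋆[lsmul ℝ ℝ] h) :=
    hρ.hasCompactSupport.continuous_convolution_left _ hρ.contDiff.continuous hh
  filter_upwards [ContDiffBump.ae_convolution_tendsto_right_of_locallyIntegrable (μ := volume)
    (φ := b) (K := 2) hb (.of_forall fun k => by simp [b, mul_div_cancel₀]) hh] with z h_lim hz
  refine tendsto_nhds_unique h_lim
    ((ContDiffBump.convolution_tendsto_right_of_continuous (μ := volume) hb hcont z).congr' ?_)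
  filter_upwards [hb.eventually_le_const hδ] with k hk
  refine hρ.convolution_convolution_eq hh hU (b k).contDiff_normed ?_ hz
  rw [(b k).tsupport_normed_eq]
  exact Metric.closedBall_subset_closedBall hk

theorem IsWeakDbar.exists_differentiableOn (hD : IsOpen D) (hh : IsWeakDbar D h 0) :
    ∃ H : (Fin n → ℂ) → ℂ, DifferentiableOn ℂ H D ∧ ∀ᵐ z, z ∈ D → h z = H z := by
  refine exists_differentiableOn_of_locally hD fun z₀ hz₀ => ?_
  obtain ⟨R, hR, hK⟩ := Metric.nhds_basis_closedBall.mem_iff.1 (hD.mem_nhds hz₀)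
  obtain ⟨ρ, hρ⟩ := exists_isCircleMollifier n (show 0 < R / 3 by positivity)
  set h₁ := (Metric.closedBall z₀ R).indicator h
  have h_eq : Set.EqOn h h₁ (Metric.ball z₀ R) := fun z hz =>
    (Set.indicator_of_mem (Metric.ball_subset_closedBall hz) h).symm
  have hint : LocallyIntegrable h₁ := ((integrable_indicator_iff
    Metric.isClosed_closedBall.measurableSet).2 (hh.1.integrableOn_compact_subset hK
      (isCompact_closedBall _ _))).locallyIntegrable
  have h_weak : IsWeakDbar (Metric.ball z₀ R) h₁ 0 :=
    (hh.mono (Metric.ball_subset_closedBall.trans hK)).congr_ae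
      (ae_restrict_of_forall_mem measurableSet_ball h_eq) fun _ => ae_eq_refl _
  have h_sub : ∀ z ∈ Metric.ball z₀ (R / 3),
      Metric.closedBall z (R / 3 + R / 3) ⊆ Metric.ball z₀ R := fun z hz w hw => by
    rw [Metric.mem_ball, Metric.mem_closedBall] at *
    linarith [dist_triangle w z z₀]
  refine ⟨Metric.ball z₀ (R / 3), ρ ⋆[lsmul ℝ ℝ] h₁, Metric.isOpen_ball,
    Metric.mem_ball_self (by positivity), fun z hz => ?_, ?_⟩
  · exact (h_weak.differentiableAt_convolution hint hρ.contDiff hρ.tsupport_subset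
      ((Metric.closedBall_subset_closedBall (by linarith)).trans
        (h_sub z hz))).differentiableWithinAt
  · filter_upwards [hρ.ae_eq_convolution hint h_weak (show 0 < R / 3 by positivity)] with z hz hzB
    rw [← hz (h_sub z hzB), h_eq (Metric.ball_subset_ball (by linarith) hzB)]

end Convolution

section WeightedMeasure

theorem locallyIntegrableOn_exp_of_upperSemicontinuousOn {X : Type*} [TopologicalSpace X]
    [MeasurableSpace X] [BorelSpace X] {μ : Measure X} [IsLocallyFiniteMeasure μ] {D : Set X}
    {ψ : X → ℝ} (hD : MeasurableSet D) (hψ : UpperSemicontinuousOn ψ D) :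
    LocallyIntegrableOn (fun z => Real.exp (ψ z)) D μ := by
  intro z hz
  have := hD.nhdsWithin_isMeasurablyGenerated z
  have h_meas : AEMeasurable ψ (μ.restrict D) :=
    aemeasurable_restrict_of_measurable_subtype hD
      (upperSemicontinuousOn_iff_restrict.2 hψ).measurable
  refine ((μ.finiteAt_nhdsWithin z D).integrableAtFilter
    ⟨D, self_mem_nhdsWithin, (Real.measurable_exp.comp_aemeasurable h_meas).aestronglyMeasurable⟩
    ⟨Real.exp (ψ z + 1), ?_⟩)
  exact Filter.eventually_map.2 <| (hψ z hz (ψ z + 1) (lt_add_one _)).mono fun w hw => by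
    simpa using hw.le

theorem locallyIntegrableOn_exp_add {X : Type*} [TopologicalSpace X] [LocallyCompactSpace X]
    [T2Space X] [MeasurableSpace X] [OpensMeasurableSpace X]
    {μ : Measure X} {D : Set X} {q ψ : X → ℝ} (hD : IsLocallyClosed D) (hq : ContinuousOn q D)
    (hψ : LocallyIntegrableOn (fun z => Real.exp (ψ z)) D μ) :
    LocallyIntegrableOn (fun z => Real.exp ((q + ψ) z)) D μ := by
  simp only [Pi.add_apply, Real.exp_add]
  exact hψ.continuousOn_mul hq.rexp hD

variable {D : Set (Fin n → ℂ)} {θ c : (Fin n → ℂ) → ℝ} {u χ : (Fin n → ℂ) → ℂ}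

theorem aemeasurable_of_locallyIntegrableOn_exp
    (h : LocallyIntegrableOn (fun z => Real.exp (θ z)) D) : AEMeasurable θ (volume.restrict D) := by
  simpa only [Real.log_exp] using h.aestronglyMeasurable.aemeasurable.log

theorem aemeasurable_of_locallyIntegrableOn_exp_neg
    (h : LocallyIntegrableOn (fun z => Real.exp (-θ z)) D) : AEMeasurable θ (volume.restrict D) :=
  aemeasurable_neg_iff.1 (aemeasurable_of_locallyIntegrableOn_exp h)

theorem ae_weightedMeasure (hθ : AEMeasurable θ (volume.restrict D)) :
    ae (weightedMeasure D θ) = ae (volume.restrict D) :=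
  le_antisymm (withDensity_absolutelyContinuous _ _).ae_le
    (withDensity_absolutelyContinuous' (by fun_prop)
      (.of_forall fun z => by simp [Real.exp_pos])).ae_le

theorem aestronglyMeasurable_weightedMeasure_iff (hθ : AEMeasurable θ (volume.restrict D)) :
    AEStronglyMeasurable u (weightedMeasure D θ) ↔ AEStronglyMeasurable u (volume.restrict D) :=
  ⟨fun h => h.mono_ac (Measure.ae_le_iff_absolutelyContinuous.1 (ae_weightedMeasure hθ).ge),
    fun h => h.mono_ac (Measure.ae_le_iff_absolutelyContinuous.1 (ae_weightedMeasure hθ).le)⟩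

theorem integrable_weightedMeasure_iff {E : Type*} [NormedAddCommGroup E] [NormedSpace ℝ E]
    (hθ : AEMeasurable θ (volume.restrict D)) {f : (Fin n → ℂ) → E} :
    Integrable f (weightedMeasure D θ) ↔ IntegrableOn (fun z => Real.exp (-θ z) • f z) D := by
  rw [weightedMeasure, integrable_withDensity_iff_integrable_smul₀' (by fun_prop) (by simp)]
  simp only [IntegrableOn, ENNReal.toReal_ofReal (Real.exp_pos _).le]

theorem integral_weightedMeasure {E : Type*} [NormedAddCommGroup E] [NormedSpace ℝ E]
    (hθ : AEMeasurable θ (volume.restrict D)) (f : (Fin n → ℂ) → E) :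
    ∫ z, f z ∂weightedMeasure D θ = ∫ z in D, Real.exp (-θ z) • f z := by
  rw [weightedMeasure, integral_withDensity_eq_integral_toReal_smul₀ (by fun_prop) (by simp)]
  simp only [ENNReal.toReal_ofReal (Real.exp_pos _).le]

theorem locallyIntegrableOn_smul_of_memLp (hθ : AEMeasurable θ (volume.restrict D))
    (hcm : AEMeasurable c (volume.restrict D))
    (hc : LocallyIntegrableOn (fun z => Real.exp (-θ z) * c z ^ 2) D)
    (hu : MemLp u 2 (weightedMeasure D θ)) :
    LocallyIntegrableOn (fun z => (Real.exp (-θ z) * c z) • u z) D := by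
  have hum : AEStronglyMeasurable u (volume.restrict D) :=
    (aestronglyMeasurable_weightedMeasure_iff hθ).1 hu.1
  have hu_sq : IntegrableOn (fun z => Real.exp (-θ z) * ‖u z‖ ^ 2) D :=
    (integrable_weightedMeasure_iff hθ).1 ((memLp_two_iff_integrable_sq_norm hu.1).1 hu)
  have hcu : AEMeasurable (fun z => Real.exp (-θ z) * c z) (volume.restrict D) := by fun_prop
  intro w hw
  obtain ⟨s, hs, h_int⟩ := (hc.add hu_sq.locallyIntegrableOn) w hw
  refine ⟨s ∩ D, Filter.inter_mem hs self_mem_nhdsWithin,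
    (h_int.mono_set Set.inter_subset_left).mono'
      ((hcu.aestronglyMeasurable.smul hum).mono_set Set.inter_subset_right)
      (.of_forall fun z => ?_)⟩
  have h_amgm : |c z| * ‖u z‖ ≤ c z ^ 2 + ‖u z‖ ^ 2 := by
    nlinarith [sq_nonneg (|c z| - ‖u z‖), sq_abs (c z), sq_nonneg (c z), sq_nonneg ‖u z‖]
  calc ‖(Real.exp (-θ z) * c z) • u z‖ = Real.exp (-θ z) * (|c z| * ‖u z‖) := by
        rw [norm_smul, norm_mul, Real.norm_eq_abs, Real.abs_exp, Real.norm_eq_abs, mul_assoc]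
    _ ≤ Real.exp (-θ z) * (c z ^ 2 + ‖u z‖ ^ 2) := by gcongr
    _ = Real.exp (-θ z) * c z ^ 2 + Real.exp (-θ z) * ‖u z‖ ^ 2 := mul_add _ _ _

theorem IsTestFunction.conj (hχ : IsTestFunction D χ) : IsTestFunction D fun z => star (χ z) := by
  have h_sub : tsupport (fun z => star (χ z)) ⊆ tsupport χ :=
    closure_mono fun z hz => by simpa using hz
  exact ⟨Complex.conjCLE.contDiff.comp hχ.1, hχ.2.1.of_isClosed_subset (isClosed_tsupport _) h_sub,
    h_sub.trans hχ.2.2⟩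

theorem IsTestFunction.memLp_smul (hχ : IsTestFunction D χ) (hD : IsOpen D)
    (hθ : AEMeasurable θ (volume.restrict D)) (hcm : AEMeasurable c (volume.restrict D))
    (hc : LocallyIntegrableOn (fun z => Real.exp (-θ z) * c z ^ 2) D) :
    MemLp (fun z => c z • χ z) 2 (weightedMeasure D θ) := by
  have h_meas : AEStronglyMeasurable (fun z => c z • χ z) (weightedMeasure D θ) :=
    (aestronglyMeasurable_weightedMeasure_iff hθ).2
      (hcm.aestronglyMeasurable.smul hχ.1.continuous.aestronglyMeasurable)
  rw [memLp_two_iff_integrable_sq_norm h_meas, integrable_weightedMeasure_iff hθ]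
  have h_int : IntegrableOn (fun z => Real.exp (-θ z) * c z ^ 2 * ‖χ z‖ ^ 2) (tsupport χ) :=
    (hc.integrableOn_compact_subset hχ.2.2 hχ.2.1).mul_continuousOn
      (hχ.1.continuous.norm.pow 2).continuousOn hχ.2.1
  refine (h_int.congr_fun (fun z _ => ?_) (isClosed_tsupport _).measurableSet)
    |>.of_forall_sdiff_eq_zero hD.measurableSet fun z hz => ?_
  · simp [mul_pow, mul_assoc]
  · simp [image_eq_zero_of_notMem_tsupport hz.2]

theorem inner_toLp_smul (hθ : AEMeasurable θ (volume.restrict D))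
    (hχ : MemLp (fun z => c z • χ z) 2 (weightedMeasure D θ)) (h : L2 D θ) :
    inner ℂ hχ.toLp h = ∫ z in D, (Real.exp (-θ z) * c z) • h z * star (χ z) := by
  have h_inner : inner ℂ hχ.toLp h
      = ∫ z, c z • h z * star (χ z) ∂weightedMeasure D θ := by
    rw [L2.inner_def]
    refine integral_congr_ae (hχ.coeFn_toLp.mono fun z hz => ?_)
    dsimp only
    rw [hz]
    simp only [RCLike.inner_apply, Complex.real_smul, map_mul, Complex.conj_ofReal,
      Complex.star_def]
    ring
  rw [h_inner, integral_weightedMeasure hθ]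
  simp only [mul_smul, smul_mul_assoc]

theorem exp_neg_mul_exp_sq (t : ℝ) : Real.exp (-t) * Real.exp t ^ 2 = Real.exp t := by
  rw [sq, ← mul_assoc, ← Real.exp_add, neg_add_cancel, Real.exp_zero, one_mul]

theorem locallyIntegrableOn_of_memLp (hexp : LocallyIntegrableOn (fun z => Real.exp (θ z)) D)
    (hu : MemLp u 2 (weightedMeasure D θ)) : LocallyIntegrableOn u D := by
  have hθ := aemeasurable_of_locallyIntegrableOn_exp hexp
  simpa [← Real.exp_add] using locallyIntegrableOn_smul_of_memLp hθ hθ.exp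
    (by simpa only [exp_neg_mul_exp_sq] using hexp) hu

theorem IsTestFunction.exists_inner_eq_integral (hχ : IsTestFunction D χ) (hD : IsOpen D)
    (hexp : LocallyIntegrableOn (fun z => Real.exp (θ z)) D) :
    ∃ e : L2 D θ, ∀ h : L2 D θ, inner ℂ e h = ∫ z in D, h z * χ z := by
  have hθ := aemeasurable_of_locallyIntegrableOn_exp hexp
  have hL := hχ.conj.memLp_smul hD hθ hθ.exp (by simpa only [exp_neg_mul_exp_sq] using hexp)
  refine ⟨hL.toLp, fun h => ?_⟩
  rw [inner_toLp_smul hθ hL]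
  simp only [← Real.exp_add, neg_add_cancel, Real.exp_zero, one_smul, star_star]

end WeightedMeasure

section Dbar

variable {D : Set (Fin n → ℂ)} {θ : (Fin n → ℂ) → ℝ} {u : L2 D θ} {f : L2Form D θ}
  {χ : (Fin n → ℂ) → ℂ}

theorem mem_dbarGraph_iff (hθ : AEMeasurable θ (volume.restrict D)) :
    (u, f) ∈ dbarGraph D θ ↔ IsWeakDbar D u fun j => f j := by
  refine ⟨?_, fun h => ⟨u, fun j => f j, ae_eq_refl _, fun _ => ae_eq_refl _, h⟩⟩
  rintro ⟨v, g, hu, hf, h⟩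
  simp only [Filter.EventuallyEq, ae_weightedMeasure hθ] at hu hf
  exact h.congr_ae (.symm hu) fun j => .symm (hf j)

theorem exists_dbar_eq_iff (hD : IsOpen D) (hθ : AEMeasurable θ (volume.restrict D)) :
    (∃ hu : u ∈ (dbar D θ).domain, dbar D θ ⟨u, hu⟩ = f) ↔ IsWeakDbar D u fun j => f j := by
  rw [← mem_dbarGraph_iff hθ, ← dbar_graph hD hθ, LinearPMap.mem_graph_iff]
  constructor
  · rintro ⟨hu, hf⟩
    exact ⟨⟨u, hu⟩, rfl, hf⟩
  · rintro ⟨⟨_, hv⟩, rfl, hf⟩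
    exact ⟨hv, hf⟩

/-- The weighted Bergman space `A²(D, θ)`, the kernel of `∂̄` on `L²(D, θ)`: the classes of the
square integrable holomorphic functions. -/
noncomputable def bergmanSpace (D : Set (Fin n → ℂ)) (θ : (Fin n → ℂ) → ℝ) :
    Submodule ℂ (L2 D θ) :=
  (dbarGraph D θ).comap (LinearMap.inl ℂ (L2 D θ) (L2Form D θ))

theorem mem_bergmanSpace_iff_isWeakDbar (hθ : AEMeasurable θ (volume.restrict D)) :
    u ∈ bergmanSpace D θ ↔ IsWeakDbar D u 0 := by
  have h_zero : ∀ j, ((0 : L2Form D θ) j : (Fin n → ℂ) → ℂ) =ᵐ[volume.restrict D] 0 := by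
    rw [← ae_weightedMeasure hθ]
    exact fun _ => Lp.coeFn_zero ℂ 2 _
  exact (mem_dbarGraph_iff hθ).trans ⟨fun h => h.congr_ae (ae_eq_refl _) h_zero,
    fun h => h.congr_ae (ae_eq_refl _) fun j => (h_zero j).symm⟩

theorem mem_bergmanSpace_iff_exists_dbar_eq_zero (hD : IsOpen D)
    (hθ : AEMeasurable θ (volume.restrict D)) :
    u ∈ bergmanSpace D θ ↔ ∃ hu : u ∈ (dbar D θ).domain, dbar D θ ⟨u, hu⟩ = 0 :=
  ((exists_dbar_eq_iff hD hθ).trans (mem_dbarGraph_iff hθ).symm).symm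

theorem mem_bergmanSpace_iff_exists_differentiableOn (hD : IsOpen D)
    (hθ : AEMeasurable θ (volume.restrict D)) :
    u ∈ bergmanSpace D θ ↔
      ∃ H : (Fin n → ℂ) → ℂ, DifferentiableOn ℂ H D ∧ u =ᵐ[weightedMeasure D θ] H := by
  simp only [mem_bergmanSpace_iff_isWeakDbar hθ, Filter.EventuallyEq, ae_weightedMeasure hθ]
  constructor
  · intro h
    obtain ⟨H, hH, hu⟩ := h.exists_differentiableOn hD
    exact ⟨H, hH, (ae_restrict_iff' hD.measurableSet).2 hu⟩
  · rintro ⟨H, hH, hu⟩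
    exact (isWeakDbar_zero_of_differentiableOn hD hH).congr_ae (.symm hu) fun _ => ae_eq_refl _

theorem isClosed_bergmanSpace (hD : IsOpen D)
    (hexp : LocallyIntegrableOn (fun z => Real.exp (θ z)) D) :
    IsClosed (bergmanSpace D θ : Set (L2 D θ)) := by
  have hθ := aemeasurable_of_locallyIntegrableOn_exp hexp
  have h_eq : (bergmanSpace D θ : Set (L2 D θ)) =
      ⋂ (χ : (Fin n → ℂ) → ℂ) (_ : IsTestFunction D χ) (j : Fin n),
        {u : L2 D θ | ∫ z in D, u z * dzbar j χ z = 0} := by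
    ext u
    simp only [SetLike.mem_coe, mem_bergmanSpace_iff_isWeakDbar hθ, Set.mem_iInter,
      Set.mem_ofPred_eq]
    exact ⟨fun h χ hχ j => by simpa using h.2.2 χ hχ j, fun h =>
      ⟨locallyIntegrableOn_of_memLp hexp (Lp.memLp u), fun _ => locallyIntegrableOn_zero,
        fun χ hχ j => by simpa using h χ hχ j⟩⟩
  rw [h_eq]
  refine isClosed_iInter fun χ => isClosed_iInter fun hχ => isClosed_iInter fun j => ?_
  obtain ⟨e, he⟩ := (hχ.dzbar j).exists_inner_eq_integral hD hexp
  simp only [← he]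
  exact isClosed_eq (by fun_prop) continuous_const

/-- The tuples of elements of the weighted Bergman space, the kernel of `T₂`. -/
noncomputable def bergmanTuple (p : ℕ) (D : Set (Fin n → ℂ)) (θ : (Fin n → ℂ) → ℝ) :
    Submodule ℂ (L2Tuple p D θ) :=
  ⨅ i, (bergmanSpace D θ).comap (PiLp.proj (𝕜 := ℂ) 2 (fun _ : Fin p => L2 D θ) i).toLinearMap

theorem mem_bergmanTuple_iff {h : L2Tuple p D θ} :
    h ∈ bergmanTuple p D θ ↔ ∀ i, h i ∈ bergmanSpace D θ := by
  simp [bergmanTuple]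

theorem isClosed_bergmanTuple (hD : IsOpen D)
    (hexp : LocallyIntegrableOn (fun z => Real.exp (θ z)) D) :
    IsClosed (bergmanTuple p D θ : Set (L2Tuple p D θ)) := by
  have h_eq : (bergmanTuple p D θ : Set (L2Tuple p D θ))
      = ⋂ i, (fun h : L2Tuple p D θ => h i) ⁻¹' (bergmanSpace D θ) := by
    ext h
    simp [mem_bergmanTuple_iff]
  rw [h_eq]
  exact isClosed_iInter fun i => (isClosed_bergmanSpace hD hexp).preimage
    (PiLp.continuous_apply 2 (fun _ : Fin p => L2 D θ) i)

theorem sub_mem_bergmanTuple (hθ : AEMeasurable θ (volume.restrict D)) {h k : L2Tuple p D θ}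
    {F : L2FormTuple p D θ} (hh : ∀ i, IsWeakDbar D (h i) fun j => F i j)
    (hk : ∀ i, IsWeakDbar D (k i) fun j => F i j) : h - k ∈ bergmanTuple p D θ := by
  refine mem_bergmanTuple_iff.2 fun i => ?_
  have h_sub := (dbarGraph D θ).sub_mem ((mem_dbarGraph_iff hθ).2 (hh i))
    ((mem_dbarGraph_iff hθ).2 (hk i))
  rwa [Prod.mk_sub_mk, sub_self] at h_sub

theorem inner_adjoint_T₂_eq_zero (hD : IsOpen D) (hθ : AEMeasurable θ (volume.restrict D))
    (hd : Dense ((T₂ p D θ).domain : Set (L2Tuple p D θ))) (v : (T₂ p D θ).adjoint.domain)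
    {h : L2Tuple p D θ} (hh : h ∈ bergmanTuple p D θ) :
    inner ℂ h ((T₂ p D θ).adjoint v) = 0 := by
  have h_comp := fun i =>
    (mem_bergmanSpace_iff_exists_dbar_eq_zero hD hθ).1 (mem_bergmanTuple_iff.1 hh i)
  let k : (T₂ p D θ).domain := ⟨h, fun i => (h_comp i).1⟩
  have hk : T₂ p D θ k = 0 := by
    ext i : 1
    exact (h_comp i).2
  rw [← inner_conj_symm, LinearPMap.adjoint_isFormalAdjoint hd v k, hk, inner_zero_right, map_zero]

theorem IsTestFunction.memLp (hχ : IsTestFunction D χ) (hD : IsOpen D)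
    (hexp : LocallyIntegrableOn (fun z => Real.exp (-θ z)) D) :
    MemLp χ 2 (weightedMeasure D θ) := by
  have hθ := aemeasurable_of_locallyIntegrableOn_exp_neg hexp
  simpa using hχ.memLp_smul (c := fun _ => 1) hD hθ aemeasurable_const (by simpa using hexp)

theorem IsTestFunction.inner_toLp (hχ : IsTestFunction D χ) (hD : IsOpen D)
    (hexp : LocallyIntegrableOn (fun z => Real.exp (-θ z)) D) (u : L2 D θ) :
    inner ℂ (hχ.memLp hD hexp).toLp u = ∫ z in D, Real.exp (-θ z) • u z * star (χ z) := by
  simpa only [one_smul, mul_one] using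
    inner_toLp_smul (c := fun _ => 1) (aemeasurable_of_locallyIntegrableOn_exp_neg hexp)
      (by simpa using hχ.memLp hD hexp) u

theorem IsTestFunction.toLp_mem_domain_dbar (hχ : IsTestFunction D χ) (hD : IsOpen D)
    (hexp : LocallyIntegrableOn (fun z => Real.exp (-θ z)) D) :
    (hχ.memLp hD hexp).toLp ∈ (L2Division.dbar D θ).domain := by
  have hθ := aemeasurable_of_locallyIntegrableOn_exp_neg hexp
  have hL := fun j => (hχ.dzbar j).memLp hD hexp
  have h_ae := (hχ.memLp hD hexp).coeFn_toLp
  have h_ae' := fun j => (hL j).coeFn_toLp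
  simp only [Filter.EventuallyEq, ae_weightedMeasure hθ] at h_ae h_ae'
  exact ((exists_dbar_eq_iff (f := WithLp.toLp 2 fun j => (hL j).toLp) hD hθ).2
    ((isWeakDbar_of_contDiffOn hD hχ.1.contDiffOn).congr_ae (.symm h_ae)
      fun j => .symm (h_ae' j))).1

theorem eq_zero_of_forall_inner_testFunction (hD : IsOpen D)
    (hexp : LocallyIntegrableOn (fun z => Real.exp (-θ z)) D)
    (hu : ∀ χ (hχ : IsTestFunction D χ), inner ℂ (hχ.memLp hD hexp).toLp u = 0) : u = 0 := by
  have hθ := aemeasurable_of_locallyIntegrableOn_exp_neg hexp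
  have h_loc : LocallyIntegrableOn (fun z => Real.exp (-θ z) • u z) D := by
    simpa using locallyIntegrableOn_smul_of_memLp (c := fun _ => 1) hθ aemeasurable_const
      (by simpa using hexp) (Lp.memLp u)
  have h_ae := hD.ae_eq_zero_of_integral_contDiff_smul_eq_zero h_loc fun κ hκ hκc hκs => by
    have hχ := isTestFunction_ofReal hκ hκc hκs
    rw [← hu _ hχ, hχ.inner_toLp hD hexp, ← setIntegral_eq_integral_of_forall_compl_eq_zero (s := D)
      fun z hz => by simp [image_eq_zero_of_notMem_tsupport fun h => hz (hκs h)]]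
    refine integral_congr_ae (.of_forall fun z => ?_)
    simp only [Complex.real_smul, Complex.star_def, Complex.conj_ofReal]
    ring
  refine Lp.ext (.trans ?_ (Lp.coeFn_zero _ _ _).symm)
  rw [Filter.EventuallyEq, ae_weightedMeasure hθ, ae_restrict_iff' hD.measurableSet]
  filter_upwards [h_ae] with z hz hzD
  simpa [(Real.exp_pos _).ne'] using hz hzD

theorem dense_domain_dbar (hD : IsOpen D)
    (hexp : LocallyIntegrableOn (fun z => Real.exp (-θ z)) D) :
    Dense ((dbar D θ).domain : Set (L2 D θ)) := by
  rw [Submodule.dense_iff_topologicalClosure_eq_top, Submodule.topologicalClosure_eq_top_iff,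
    Submodule.eq_bot_iff]
  exact fun u hu => eq_zero_of_forall_inner_testFunction hD hexp fun χ hχ =>
    (Submodule.mem_orthogonal _ _).1 hu _ (hχ.toLp_mem_domain_dbar hD hexp)

theorem dense_domain_T₂ (hD : IsOpen D)
    (hexp : LocallyIntegrableOn (fun z => Real.exp (-θ z)) D) :
    Dense ((T₂ p D θ).domain : Set (L2Tuple p D θ)) := by
  have h_pi := dense_pi (Set.univ : Set (Fin p)) fun _ _ => dense_domain_dbar hD hexp
  refine (h_pi.preimage (PiLp.homeomorph 2 fun _ : Fin p => L2 D θ).isOpenMap).mono ?_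
  exact fun h hh i => hh i (Set.mem_univ i)

end Dbar

section Multiplication

variable {α ι 𝕜 : Type*} [MeasurableSpace α] {μ : Measure α} [RCLike 𝕜]

theorem ofReal_norm_sq_eq_lintegral (f : Lp 𝕜 2 μ) :
    ENNReal.ofReal (‖f‖ ^ 2) = ∫⁻ z, ‖f z‖ₑ ^ 2 ∂μ := by
  have h := eLpNorm_nnreal_pow_eq_lintegral (μ := μ) (f := f) (p := 2) two_ne_zero
  have h_cast : ((2 : NNReal) : ℝ) = (2 : ℕ) := by norm_num
  simp only [h_cast, ENNReal.rpow_natCast] at h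
  rw [ENNReal.ofReal_pow (norm_nonneg _), ofReal_norm, Lp.enorm_def, ← h]
  rfl

theorem norm_sq_eq_integral (f : Lp 𝕜 2 μ) : ‖f‖ ^ 2 = ∫ z, ‖f z‖ ^ 2 ∂μ := by
  rw [← inner_self_eq_norm_sq (𝕜 := 𝕜), L2.inner_def, ← integral_re (L2.integrable_inner f f)]
  exact integral_congr_ae (.of_forall fun z => inner_self_eq_norm_sq _)

/-- Multiplication by an essentially bounded function `G`, as a bounded operator on `L²(μ)`. -/
noncomputable def mulL2 (G : α → 𝕜) (hG : MemLp G ∞ μ) : Lp 𝕜 2 μ →L[𝕜] Lp 𝕜 2 μ :=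
  (ContinuousLinearMap.mul 𝕜 𝕜).holderL μ ∞ 2 2 hG.toLp

theorem coeFn_mulL2 {G : α → 𝕜} (hG : MemLp G ∞ μ) (u : Lp 𝕜 2 μ) :
    mulL2 G hG u =ᵐ[μ] fun z => G z * u z := by
  rw [mulL2, ContinuousLinearMap.holderL_apply_apply]
  filter_upwards [ContinuousLinearMap.coeFn_holder (r := 2) (ContinuousLinearMap.mul 𝕜 𝕜) hG.toLp u,
    hG.coeFn_toLp] with z h_holder h_toLp
  rw [h_holder, h_toLp]
  rfl

theorem adjoint_mulL2 {G : α → 𝕜} (hG : MemLp G ∞ μ) :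
    (mulL2 G hG).adjoint = mulL2 (star G) hG.star := by
  refine ((ContinuousLinearMap.eq_adjoint_iff _ _).2 fun u h => ?_).symm
  rw [L2.inner_def, L2.inner_def]
  refine integral_congr_ae ?_
  filter_upwards [coeFn_mulL2 hG h, coeFn_mulL2 hG.star u] with z hz hz_star
  rw [hz, hz_star]
  simp only [RCLike.inner_apply, Pi.star_apply, map_mul, RCLike.star_def, RCLike.conj_conj]
  ring

variable [Fintype ι] {G : ι → α → 𝕜} {c : ℝ}

theorem integrable_sum_norm_sq_mul (hG : ∀ i, MemLp (G i) ∞ μ) (u : Lp 𝕜 2 μ) :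
    Integrable (fun z => (∑ i, ‖G i z‖ ^ 2) * ‖u z‖ ^ 2) μ := by
  simp only [Finset.sum_mul, ← mul_pow, ← norm_mul]
  refine integrable_finsetSum _ fun i _ => (memLp_two_iff_integrable_sq_norm ?_).1 ?_
  · exact (hG i).1.mul (Lp.aestronglyMeasurable u)
  · exact (memLp_congr_ae (coeFn_mulL2 (hG i) u)).1 (Lp.memLp _)

theorem sum_norm_sq_mulL2 (hG : ∀ i, MemLp (G i) ∞ μ) (u : Lp 𝕜 2 μ) :
    ∑ i, ‖mulL2 (G i) (hG i) u‖ ^ 2 = ∫ z, (∑ i, ‖G i z‖ ^ 2) * ‖u z‖ ^ 2 ∂μ := by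
  simp only [norm_sq_eq_integral]
  rw [← integral_finsetSum _ fun i _ =>
    (memLp_two_iff_integrable_sq_norm (Lp.aestronglyMeasurable _)).1 (Lp.memLp _)]
  refine integral_congr_ae ?_
  filter_upwards [ae_all_iff.2 fun i => coeFn_mulL2 (hG i) u] with z hz
  simp only [hz, norm_mul, mul_pow, Finset.sum_mul]

theorem le_sum_norm_sq_mulL2 (hG : ∀ i, MemLp (G i) ∞ μ) (hc : ∀ᵐ z ∂μ, c ≤ ∑ i, ‖G i z‖ ^ 2)
    (u : Lp 𝕜 2 μ) : c * ‖u‖ ^ 2 ≤ ∑ i, ‖mulL2 (G i) (hG i) u‖ ^ 2 := by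
  rw [sum_norm_sq_mulL2, norm_sq_eq_integral, ← integral_const_mul]
  refine integral_mono_ae
    (((memLp_two_iff_integrable_sq_norm (Lp.aestronglyMeasurable u)).1 (Lp.memLp u)).const_mul c)
    (integrable_sum_norm_sq_mul hG u) (hc.mono fun z hz => ?_)
  exact mul_le_mul_of_nonneg_right hz (sq_nonneg _)

theorem sum_norm_sq_mulL2_le (hG : ∀ i, MemLp (G i) ∞ μ) (hc : ∀ᵐ z ∂μ, ∑ i, ‖G i z‖ ^ 2 ≤ c)
    (u : Lp 𝕜 2 μ) : ∑ i, ‖mulL2 (G i) (hG i) u‖ ^ 2 ≤ c * ‖u‖ ^ 2 := by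
  rw [sum_norm_sq_mulL2, norm_sq_eq_integral, ← integral_const_mul]
  refine integral_mono_ae (integrable_sum_norm_sq_mul hG u)
    (((memLp_two_iff_integrable_sq_norm (Lp.aestronglyMeasurable u)).1 (Lp.memLp u)).const_mul c)
    (hc.mono fun z hz => ?_)
  exact mul_le_mul_of_nonneg_right hz (sq_nonneg _)

theorem memLp_top_of_sum_norm_sq_le (hG : ∀ i, AEStronglyMeasurable (G i) μ)
    (hc : ∀ᵐ z ∂μ, ∑ i, ‖G i z‖ ^ 2 ≤ c) (i : ι) : MemLp (G i) ∞ μ :=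
  memLp_top_of_bound (hG i) √c <| hc.mono fun z hz => Real.le_sqrt_of_sq_le <|
    (Finset.single_le_sum (f := fun i => ‖G i z‖ ^ 2) (fun _ _ => sq_nonneg _)
      (Finset.mem_univ i)).trans hz

end Multiplication

section BoundedBelow

variable {𝕜 E F : Type*} [RCLike 𝕜] [NormedAddCommGroup E] [InnerProductSpace 𝕜 E]
  [NormedAddCommGroup F] [InnerProductSpace 𝕜 F]

theorem exists_mem_eq_of_adjoint_bounded_below [CompleteSpace E] [CompleteSpace F] (T : E →L[𝕜] F)
    {A : Submodule 𝕜 E} {B : Submodule 𝕜 F} [CompleteSpace A] [CompleteSpace B]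
    (hT : ∀ x ∈ A, T x ∈ B) {δ : ℝ} (hδ : 0 < δ)
    (h_below : ∀ y ∈ B, δ * ‖y‖ ^ 2 ≤ ‖A.orthogonalProjectionOnto (T.adjoint y)‖ ^ 2) {f : F}
    (hf : f ∈ B) : ∃ x ∈ A, T x = f := by
  let S : A →L[𝕜] B := (T.comp A.subtypeL).codRestrict B fun x => hT x x.2
  have hS : ∀ y : B, S.adjoint y = A.orthogonalProjectionOnto (T.adjoint y) := fun y => by
    refine ext_inner_right 𝕜 fun x => ?_
    rw [ContinuousLinearMap.adjoint_inner_left,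
      Submodule.inner_orthogonalProjectionOnto_eq_of_mem_right,
      ContinuousLinearMap.adjoint_inner_left]
    rfl
  have h_unit : IsUnit (S.comp S.adjoint) := by
    refine ContinuousLinearMap.isUnit_of_forall_le_norm_inner_map _ (c := ⟨δ, hδ.le⟩) hδ
      fun y => ?_
    rw [ContinuousLinearMap.comp_apply, ← ContinuousLinearMap.adjoint_inner_right,
      inner_self_eq_norm_sq_to_K, norm_pow, RCLike.norm_ofReal, abs_norm, hS, mul_comm]
    exact h_below y y.2
  obtain ⟨y, hy⟩ := (ContinuousLinearMap.isUnit_iff_bijective.1 h_unit).2 ⟨f, hf⟩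
  exact ⟨S.adjoint y, (S.adjoint y).2, congrArg Subtype.val hy⟩

theorem norm_sq_sub_norm_sq_le_orthogonalProjectionOnto (A : Submodule 𝕜 E)
    [A.HasOrthogonalProjection] {w s : E} (h : w - s ∈ A) :
    ‖w‖ ^ 2 - ‖s‖ ^ 2 ≤ ‖A.orthogonalProjectionOnto w‖ ^ 2 := by
  have h_eq : Aᗮ.orthogonalProjectionOnto w = Aᗮ.orthogonalProjectionOnto s := by
    rw [← sub_eq_zero, ← map_sub]
    exact Submodule.orthogonalProjectionOnto_orthogonal_apply_eq_zero h
  have h_le : ‖Aᗮ.orthogonalProjectionOnto s‖ ^ 2 ≤ ‖s‖ ^ 2 := by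
    gcongr
    exact Submodule.norm_orthogonalProjectionOnto_apply_le _ _
  have h_pythagoras := A.norm_sq_eq_add_norm_sq_projection w
  rw [h_eq] at h_pythagoras
  linarith

end BoundedBelow

section DivisionOperator

variable {D : Set (Fin n → ℂ)} {θ : (Fin n → ℂ) → ℝ} {g : Fin p → (Fin n → ℂ) → ℂ}

theorem ae_weightedMeasure_of_forall_mem (hD : MeasurableSet D) {P : (Fin n → ℂ) → Prop}
    (h : ∀ z ∈ D, P z) : ∀ᵐ z ∂weightedMeasure D θ, P z :=
  (withDensity_absolutelyContinuous _ _).ae_le (ae_restrict_of_forall_mem hD h)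

theorem T₁_apply (hg : ∀ i, MemLp (g i) ∞ (weightedMeasure D θ)) (h : L2Tuple p D θ) :
    T₁ D θ g hg h = ∑ i, mulL2 (g i) (hg i) (h i) := by
  simp [T₁, mulL2]

theorem coeFn_T₁ (hg : ∀ i, MemLp (g i) ∞ (weightedMeasure D θ)) (h : L2Tuple p D θ) :
    T₁ D θ g hg h =ᵐ[weightedMeasure D θ] fun z => ∑ i, h i z * g i z := by
  rw [T₁_apply]
  filter_upwards [Lp.coeFn_finsetSum Finset.univ fun i => mulL2 (g i) (hg i) (h i),
    ae_all_iff.2 fun i => coeFn_mulL2 (hg i) (h i)] with z h_sum h_mul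
  simp only [h_sum, Finset.sum_apply, h_mul, mul_comm]

theorem adjoint_T₁_apply (hg : ∀ i, MemLp (g i) ∞ (weightedMeasure D θ)) (u : L2 D θ) :
    (T₁ D θ g hg).adjoint u = WithLp.toLp 2 fun i => mulL2 (star (g i)) (hg i).star u := by
  refine ext_inner_right ℂ fun h => ?_
  rw [ContinuousLinearMap.adjoint_inner_left, T₁_apply, inner_sum, PiLp.inner_apply]
  refine Finset.sum_congr rfl fun i _ => ?_
  dsimp only
  rw [← adjoint_mulL2 (hg i), ContinuousLinearMap.adjoint_inner_left]

theorem T₁_mem_bergmanSpace (hD : IsOpen D) (hθ : AEMeasurable θ (volume.restrict D))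
    (hg : ∀ i, MemLp (g i) ∞ (weightedMeasure D θ)) (hgd : ∀ i, DifferentiableOn ℂ (g i) D)
    {h : L2Tuple p D θ} (hh : h ∈ bergmanTuple p D θ) : T₁ D θ g hg h ∈ bergmanSpace D θ := by
  simp only [mem_bergmanTuple_iff, mem_bergmanSpace_iff_exists_differentiableOn hD hθ] at hh
  choose H hH hh_ae using hh
  refine (mem_bergmanSpace_iff_exists_differentiableOn hD hθ).2
    ⟨fun z => ∑ i, H i z * g i z, .fun_sum fun i _ => (hH i).mul (hgd i), ?_⟩
  filter_upwards [coeFn_T₁ hg h, ae_all_iff.2 hh_ae] with z hz hzH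
  simp only [hz, hzH]

theorem le_norm_sq_adjoint_T₁ (hD : MeasurableSet D)
    (hg : ∀ i, MemLp (g i) ∞ (weightedMeasure D θ)) {m : ℝ}
    (hm : ∀ z ∈ D, m ≤ ∑ i, ‖g i z‖ ^ 2) (u : L2 D θ) :
    m * ‖u‖ ^ 2 ≤ ‖(T₁ D θ g hg).adjoint u‖ ^ 2 := by
  rw [adjoint_T₁_apply, PiLp.norm_sq_eq_of_L2]
  refine le_sum_norm_sq_mulL2 (fun i => (hg i).star) ?_ u
  simpa only [Pi.star_apply, norm_star] using ae_weightedMeasure_of_forall_mem hD hm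

theorem exists_isWeakDbar_adjoint_T₁ (hD : IsOpen D) (hθ : AEMeasurable θ (volume.restrict D))
    (hg : ∀ i, MemLp (g i) ∞ (weightedMeasure D θ)) (hgd : ∀ i, DifferentiableOn ℂ (g i) D)
    {M : ℝ} (hM : ∀ z ∈ D, ∑ i, ∑ k, ‖dz k (g i) z‖ ^ 2 ≤ M) {u : L2 D θ}
    (hu : u ∈ bergmanSpace D θ) :
    ∃ F : L2FormTuple p D θ, (∀ i, IsWeakDbar D ((T₁ D θ g hg).adjoint u i) fun j => F i j) ∧
      ‖F‖ ^ 2 ≤ M * ‖u‖ ^ 2 := by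
  have hgs : ∀ i, ContDiffOn ℝ ∞ (star (g i)) D := fun i =>
    Complex.conjCLE.contDiff.comp_contDiffOn (contDiffOn_of_differentiableOn hD (hgd i))
  let G : Fin p × Fin n → (Fin n → ℂ) → ℂ := fun q => dzbar q.2 (star (g q.1))
  have h_sum : ∀ᵐ z ∂weightedMeasure D θ, ∑ q, ‖G q z‖ ^ 2 ≤ M := by
    refine ae_weightedMeasure_of_forall_mem hD.measurableSet fun z hz => ?_
    have h_star : ∀ i j, ‖dzbar j (star (g i)) z‖ = ‖dz j (g i) z‖ := fun i j => by
      rw [← norm_star (dz j (g i) z), ← dzbar_star]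
      rfl
    simpa only [Fintype.sum_prod_type, G, h_star] using hM z hz
  have hG : ∀ q, MemLp (G q) ∞ (weightedMeasure D θ) :=
    memLp_top_of_sum_norm_sq_le (fun q => (aestronglyMeasurable_weightedMeasure_iff hθ).2
      ((continuousOn_dzbar hD (hgs q.1) q.2).aestronglyMeasurable hD.measurableSet)) h_sum
  refine ⟨WithLp.toLp 2 fun i => WithLp.toLp 2 fun j => mulL2 (G (i, j)) (hG (i, j)) u,
    fun i => ?_, ?_⟩
  · have h_adj := coeFn_mulL2 (hg i).star u
    have h_form := fun j => coeFn_mulL2 (hG (i, j)) u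
    simp only [Filter.EventuallyEq, ae_weightedMeasure hθ] at h_adj h_form
    rw [adjoint_T₁_apply]
    refine (((mem_bergmanSpace_iff_isWeakDbar hθ).1 hu).mul_contDiffOn hD (hgs i)).congr_ae
      (h_adj.mono fun z hz => ?_) fun j => (h_form j).mono fun z hz => ?_
    · simp only [hz, mul_comm]
    · simp only [hz, Pi.zero_apply, zero_mul, zero_add, G, mul_comm]
  · simpa only [PiLp.norm_sq_eq_of_L2, Fintype.sum_prod_type] using
      sum_norm_sq_mulL2_le hG h_sum u

end DivisionOperator

section QuadraticWeight

theorem dz_apply_eq (j k : Fin n) (z : Fin n → ℂ) :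
    dz j (fun w => w k) z = if k = j then 1 else 0 := by
  have h_fderiv : fderiv ℝ (fun w : Fin n → ℂ => w k) z
      = ContinuousLinearMap.proj (R := ℝ) (φ := fun _ : Fin n => ℂ) k :=
    (ContinuousLinearMap.proj (R := ℝ) (φ := fun _ : Fin n => ℂ) k).fderiv
  rw [dz, h_fderiv]
  simp only [ContinuousLinearMap.proj_apply, Pi.single_apply]
  split_ifs
  · norm_num
  · simp

theorem contDiff_quadraticWeight (a : ℝ) : ContDiff ℝ ∞ (quadraticWeight n a) := by
  unfold quadraticWeight
  exact contDiff_const.mul (ContDiff.sum fun i _ => (contDiff_apply ℝ ℂ i).norm_sq ℝ)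

theorem dzbar_quadraticWeight (a : ℝ) (k : Fin n) (z : Fin n → ℂ) :
    dzbar k (fun w => (quadraticWeight n a w : ℂ)) z = a * z k := by
  have h_weight : (fun w => (quadraticWeight n a w : ℂ))
      = fun w : Fin n → ℂ => ∑ i, (a * w i) * star (w i) := by
    ext w
    simp [quadraticWeight, Complex.mul_conj, Complex.normSq_eq_norm_sq, Finset.mul_sum, mul_assoc]
  have hd : ∀ i, DifferentiableAt ℂ (fun w : Fin n → ℂ => (a : ℂ) * w i) z := fun i => by fun_prop
  have hd_star : ∀ i, DifferentiableAt ℝ (fun w : Fin n → ℂ => star (w i)) z := fun i =>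
    Complex.conjCLE.differentiableAt.comp z (by fun_prop)
  have hd_mul : ∀ i, DifferentiableAt ℝ (fun w : Fin n → ℂ => (a * w i) * star (w i)) z :=
    fun i => ((hd i).restrictScalars ℝ).mul (hd_star i)
  rw [h_weight, dzbar_fun_sum fun i _ => hd_mul i]
  have h_term : ∀ i, dzbar k (fun w : Fin n → ℂ => (a * w i) * star (w i)) z
      = if i = k then a * z i else 0 := fun i => by
    rw [dzbar_fun_mul ((hd i).restrictScalars ℝ) (hd_star i), dzbar_star, dz_apply_eq,
      dzbar_eq_zero (hd i)]
    split_ifs <;> simp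
  simp only [h_term, Finset.sum_ite_eq', Finset.mem_univ, if_true]

theorem curvatureMatrix_quadraticWeight (a : ℝ) (z : Fin n → ℂ) :
    curvatureMatrix (quadraticWeight n a) z = (a : ℂ) • (1 : Matrix (Fin n) (Fin n) ℂ) := by
  ext k j
  have h_dzbar : dzbar k (fun w => (quadraticWeight n a w : ℂ))
      = fun w : Fin n → ℂ => (a : ℂ) * w k := funext (dzbar_quadraticWeight a k)
  have h_dz : dz j (fun w : Fin n → ℂ => (a : ℂ) * w k) z = a * dz j (fun w => w k) z := by
    unfold dz
    rw [fderiv_const_mul (by fun_prop)]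
    simp only [smul_apply, smul_eq_mul]
    ring
  rw [curvatureMatrix, Matrix.of_apply, h_dzbar, h_dz, dz_apply_eq]
  simp [Matrix.one_apply]

theorem isSmoothStrictlyPsh_quadraticWeight {a : ℝ} (ha : 0 < a) :
    IsSmoothStrictlyPsh (quadraticWeight n a) := by
  refine ⟨contDiff_quadraticWeight a, fun z => ?_⟩
  rw [curvatureMatrix_quadraticWeight]
  exact Matrix.PosDef.one.smul (by exact_mod_cast ha)

theorem curvatureInvForm_quadraticWeight {a : ℝ} (ha : a ≠ 0) (f : Fin n → (Fin n → ℂ) → ℂ)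
    (z : Fin n → ℂ) :
    curvatureInvForm (quadraticWeight n a) f z = a⁻¹ * ∑ k, ‖f k z‖ ^ 2 := by
  have h_inv : ((a : ℂ) • (1 : Matrix (Fin n) (Fin n) ℂ))⁻¹ = ((a⁻¹ : ℝ) : ℂ) • 1 := by
    refine Matrix.inv_eq_right_inv ?_
    rw [smul_mul_smul_comm, ← Complex.ofReal_mul, mul_inv_cancel₀ ha, Complex.ofReal_one, one_smul,
      one_mul]
  rw [curvatureInvForm, curvatureMatrix_quadraticWeight, h_inv, Finset.mul_sum, Complex.re_sum]
  refine Finset.sum_congr rfl fun k _ => ?_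
  rw [Matrix.smul_mulVec, Matrix.one_mulVec, Pi.smul_apply, smul_eq_mul, mul_assoc,
    Complex.star_def, Complex.mul_conj, Complex.normSq_eq_norm_sq, ← Complex.ofReal_mul,
    Complex.ofReal_re]

theorem lintegral_curvatureInvForm_quadraticWeight {μ : Measure (Fin n → ℂ)} {a : ℝ} (ha : 0 < a)
    (f : PiLp 2 fun _ : Fin n => Lp ℂ 2 μ) :
    ∫⁻ z, ENNReal.ofReal (curvatureInvForm (quadraticWeight n a) (fun j => f j) z) ∂μ
      = ENNReal.ofReal (a⁻¹ * ‖f‖ ^ 2) := by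
  have h_point : ∀ z, ENNReal.ofReal (curvatureInvForm (quadraticWeight n a) (fun j => f j) z)
      = ENNReal.ofReal a⁻¹ * ∑ k, ‖f k z‖ₑ ^ 2 := fun z => by
    rw [curvatureInvForm_quadraticWeight ha.ne', ENNReal.ofReal_mul (by positivity),
      ENNReal.ofReal_sum_of_nonneg fun _ _ => by positivity]
    simp only [ENNReal.ofReal_pow (norm_nonneg _), ofReal_norm]
  simp only [h_point]
  rw [lintegral_const_mul' _ _ ENNReal.ofReal_ne_top, lintegral_finsetSum' _ fun k _ =>
    (Lp.aestronglyMeasurable (f k)).enorm.pow_const 2, ENNReal.ofReal_mul (by positivity),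
    PiLp.norm_sq_eq_of_L2, ENNReal.ofReal_sum_of_nonneg fun _ _ => by positivity]
  simp only [ofReal_norm_sq_eq_lintegral]

end QuadraticWeight

section Estimate

variable {D : Set (Fin n → ℂ)} {ψ : (Fin n → ℂ) → ℝ} {a : ℝ}

theorem IsL2Optimal.exists_solution (hψ : IsL2Optimal D ψ) (ha : 0 < a)
    (hψm : AEMeasurable ψ (volume.restrict D)) (f : L2Form D (quadraticWeight n a + ψ))
    (hf : IsDbarClosed D fun j => f j) :
    ∃ s : L2 D (quadraticWeight n a + ψ), IsWeakDbar D s (fun j => f j) ∧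
      a * ‖s‖ ^ 2 ≤ ‖f‖ ^ 2 := by
  have hθ : AEMeasurable (quadraticWeight n a + ψ) (volume.restrict D) :=
    (contDiff_quadraticWeight a).continuous.measurable.aemeasurable.add hψm
  have h_curv := lintegral_curvatureInvForm_quadraticWeight ha f
  obtain ⟨s, hs, hsf, hle⟩ := hψ _ (isSmoothStrictlyPsh_quadraticWeight ha) (fun j => f j)
    (fun j => Lp.memLp (f j)) hf (by rw [h_curv]; exact ENNReal.ofReal_lt_top)
  have h_ae := hs.coeFn_toLp
  refine ⟨hs.toLp, hsf.congr_ae ?_ fun j => ae_eq_refl _, ?_⟩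
  · rw [← ae_weightedMeasure hθ]
    exact h_ae.symm
  · have h_norm : ENNReal.ofReal (‖hs.toLp‖ ^ 2) ≤ ENNReal.ofReal (a⁻¹ * ‖f‖ ^ 2) := by
      rw [ofReal_norm_sq_eq_lintegral, ← h_curv]
      exact (lintegral_congr_ae (h_ae.mono fun z hz => by simp only [hz])).trans_le hle
    rwa [ENNReal.ofReal_le_ofReal_iff (by positivity), inv_mul_eq_div, le_div_iff₀' ha] at h_norm

theorem IsL2Optimal.exists_solution_tuple (hψ : IsL2Optimal D ψ) (ha : 0 < a)
    (hψm : AEMeasurable ψ (volume.restrict D)) (f : L2FormTuple p D (quadraticWeight n a + ψ))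
    (hf : ∀ i, IsDbarClosed D fun j => f i j) :
    ∃ s : L2Tuple p D (quadraticWeight n a + ψ), (∀ i, IsWeakDbar D (s i) fun j => f i j) ∧
      a * ‖s‖ ^ 2 ≤ ‖f‖ ^ 2 := by
  choose s hs hle using fun i => hψ.exists_solution ha hψm (f i) (hf i)
  refine ⟨WithLp.toLp 2 s, hs, ?_⟩
  rw [PiLp.norm_sq_eq_of_L2, PiLp.norm_sq_eq_of_L2, Finset.mul_sum]
  exact Finset.sum_le_sum fun i _ => hle i

variable {g : Fin p → (Fin n → ℂ) → ℂ} {m M : ℝ}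

theorem IsL2Optimal.le_norm_sq_orthogonalProjectionOnto_adjoint_T₁ (hψ : IsL2Optimal D ψ)
    (hD : IsOpen D) (ha : 0 < a) (hψm : AEMeasurable ψ (volume.restrict D))
    [(bergmanTuple p D (quadraticWeight n a + ψ)).HasOrthogonalProjection]
    (hg : ∀ i, MemLp (g i) ∞ (weightedMeasure D (quadraticWeight n a + ψ)))
    (hgd : ∀ i, DifferentiableOn ℂ (g i) D) (hm : ∀ z ∈ D, m ≤ ∑ i, ‖g i z‖ ^ 2)
    (hM : ∀ z ∈ D, ∑ i, ∑ k, ‖dz k (g i) z‖ ^ 2 ≤ M) {u : L2 D (quadraticWeight n a + ψ)}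
    (hu : u ∈ bergmanSpace D (quadraticWeight n a + ψ)) :
    (m - M / a) * ‖u‖ ^ 2 ≤ ‖(bergmanTuple p D (quadraticWeight n a + ψ)).orthogonalProjectionOnto
      ((T₁ D _ g hg).adjoint u)‖ ^ 2 := by
  have hθ : AEMeasurable (quadraticWeight n a + ψ) (volume.restrict D) :=
    (contDiff_quadraticWeight a).continuous.measurable.aemeasurable.add hψm
  obtain ⟨F, hF, hFM⟩ := exists_isWeakDbar_adjoint_T₁ hD hθ hg hgd hM hu
  obtain ⟨s, hs, hsF⟩ := hψ.exists_solution_tuple ha hψm F fun i => (hF i).isDbarClosed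
  have h_proj := norm_sq_sub_norm_sq_le_orthogonalProjectionOnto _ (sub_mem_bergmanTuple hθ hF hs)
  have h_lower := le_norm_sq_adjoint_T₁ hD.measurableSet hg hm u
  have h_s : ‖s‖ ^ 2 ≤ M / a * ‖u‖ ^ 2 := by
    rw [div_mul_eq_mul_div, le_div_iff₀' ha]
    exact hsF.trans hFM
  linarith

theorem locallyIntegrableOn_exp_quadraticWeight_add (hD : IsOpen D) (a : ℝ)
    (h_exp : LocallyIntegrableOn (fun z => Real.exp (ψ z)) D) :
    LocallyIntegrableOn (fun z => Real.exp ((quadraticWeight n a + ψ) z)) D :=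
  locallyIntegrableOn_exp_add hD.isLocallyClosed
    (contDiff_quadraticWeight a).continuous.continuousOn h_exp

theorem locallyIntegrableOn_exp_neg_quadraticWeight_add (hD : IsOpen D) (a : ℝ)
    (h_exp_neg : LocallyIntegrableOn (fun z => Real.exp (-ψ z)) D) :
    LocallyIntegrableOn (fun z => Real.exp (-(quadraticWeight n a + ψ) z)) D := by
  have h_neg : ∀ z, -(quadraticWeight n a + ψ) z = (quadraticWeight n (-a) + fun w => -ψ w) z :=
    fun z => by simp only [Pi.add_apply, quadraticWeight]; ring
  simp only [h_neg]
  exact locallyIntegrableOn_exp_quadraticWeight_add hD (-a) h_exp_neg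

theorem IsL2Optimal.le_norm_sq_adjoint_T₁_add_adjoint_T₂ (hψ : IsL2Optimal D ψ) (hD : IsOpen D)
    (ha : 0 < a) (h_exp : LocallyIntegrableOn (fun z => Real.exp (ψ z)) D)
    (h_exp_neg : LocallyIntegrableOn (fun z => Real.exp (-ψ z)) D)
    (hg : ∀ i, MemLp (g i) ∞ (weightedMeasure D (quadraticWeight n a + ψ)))
    (hgd : ∀ i, DifferentiableOn ℂ (g i) D) (hm : ∀ z ∈ D, m ≤ ∑ i, ‖g i z‖ ^ 2)
    (hM : ∀ z ∈ D, ∑ i, ∑ k, ‖dz k (g i) z‖ ^ 2 ≤ M) {u : L2 D (quadraticWeight n a + ψ)}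
    (hu : u ∈ bergmanSpace D (quadraticWeight n a + ψ))
    (v : (T₂ p D (quadraticWeight n a + ψ)).adjoint.domain) :
    (m - M / a) * ‖u‖ ^ 2 ≤ ‖(T₁ D _ g hg).adjoint u + (T₂ p D _).adjoint v‖ ^ 2 := by
  have h_exp_θ := locallyIntegrableOn_exp_quadraticWeight_add hD a h_exp
  have hθ := aemeasurable_of_locallyIntegrableOn_exp h_exp_θ
  have h_dense := dense_domain_T₂ (p := p) hD
    (locallyIntegrableOn_exp_neg_quadraticWeight_add hD a h_exp_neg)
  set K := bergmanTuple p D (quadraticWeight n a + ψ)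
  have : CompleteSpace K := (isClosed_bergmanTuple hD h_exp_θ).completeSpace_coe
  have h_orth : (T₂ p D _).adjoint v ∈ Kᗮ :=
    K.mem_orthogonal _ |>.2 fun _ hh => inner_adjoint_T₂_eq_zero hD hθ h_dense v hh
  calc (m - M / a) * ‖u‖ ^ 2
      ≤ ‖K.orthogonalProjectionOnto ((T₁ D _ g hg).adjoint u)‖ ^ 2 :=
        hψ.le_norm_sq_orthogonalProjectionOnto_adjoint_T₁ hD ha
          (aemeasurable_of_locallyIntegrableOn_exp h_exp) hg hgd hm hM hu
    _ = ‖K.orthogonalProjectionOnto ((T₁ D _ g hg).adjoint u + (T₂ p D _).adjoint v)‖ ^ 2 := by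
        rw [map_add, (K.orthogonalProjectionOnto_eq_zero_iff).2 h_orth, add_zero]
    _ ≤ ‖(T₁ D _ g hg).adjoint u + (T₂ p D _).adjoint v‖ ^ 2 := by
        gcongr
        exact K.norm_orthogonalProjectionOnto_apply_le _

theorem IsL2Optimal.exists_holomorphic_division (hψ : IsL2Optimal D ψ) (hD : IsOpen D) (ha : 0 < a)
    (h_exp : LocallyIntegrableOn (fun z => Real.exp (ψ z)) D)
    (hg : ∀ i, MemLp (g i) ∞ (weightedMeasure D (quadraticWeight n a + ψ)))
    (hgd : ∀ i, DifferentiableOn ℂ (g i) D) (hm : ∀ z ∈ D, m ≤ ∑ i, ‖g i z‖ ^ 2)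
    (hM : ∀ z ∈ D, ∑ i, ∑ k, ‖dz k (g i) z‖ ^ 2 ≤ M) (hMa : 0 < m - M / a)
    {f : (Fin n → ℂ) → ℂ} (hf : DifferentiableOn ℂ f D)
    (hf_mem : MemLp f 2 (weightedMeasure D (quadraticWeight n a + ψ))) :
    ∃ h : Fin p → (Fin n → ℂ) → ℂ,
      (∀ i, DifferentiableOn ℂ (h i) D ∧
        MemLp (h i) 2 (weightedMeasure D (quadraticWeight n a + ψ))) ∧
      ∀ z ∈ D, f z = ∑ i, h i z * g i z := by
  have h_exp_θ := locallyIntegrableOn_exp_quadraticWeight_add hD a h_exp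
  have hψm := aemeasurable_of_locallyIntegrableOn_exp h_exp
  have hθ := aemeasurable_of_locallyIntegrableOn_exp h_exp_θ
  have := (isClosed_bergmanSpace hD h_exp_θ).completeSpace_coe
  have := (isClosed_bergmanTuple (p := p) hD h_exp_θ).completeSpace_coe
  obtain ⟨h, h_mem, hTh⟩ := exists_mem_eq_of_adjoint_bounded_below (T₁ D _ g hg)
    (fun _ => T₁_mem_bergmanSpace hD hθ hg hgd) hMa
    (fun _ => hψ.le_norm_sq_orthogonalProjectionOnto_adjoint_T₁ hD ha hψm hg hgd hm hM)
    ((mem_bergmanSpace_iff_exists_differentiableOn hD hθ).2 ⟨f, hf, hf_mem.coeFn_toLp⟩)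
  simp only [mem_bergmanTuple_iff, mem_bergmanSpace_iff_exists_differentiableOn hD hθ] at h_mem
  choose H hH hH_ae using h_mem
  refine ⟨H, fun i => ⟨hH i, (Lp.memLp (h i)).ae_eq (hH_ae i)⟩, ?_⟩
  have h_div : f =ᵐ[weightedMeasure D (quadraticWeight n a + ψ)] fun z => ∑ i, H i z * g i z := by
    filter_upwards [hf_mem.coeFn_toLp, coeFn_T₁ hg h, ae_all_iff.2 hH_ae] with z hfz hTz hHz
    rw [← hfz, ← hTh, hTz]
    simp only [hHz]
  rw [Filter.EventuallyEq, ae_weightedMeasure hθ] at h_div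
  exact Measure.eqOn_open_of_ae_eq h_div hD hf.continuousOn
    (continuousOn_finsetSum _ fun i _ => (hH i).continuousOn.mul (hgd i).continuousOn)

theorem half_le_sub_div (hm : 0 < m) (ha : 0 < a) (h : 2 * M / m ≤ a) : m / 2 ≤ m - M / a := by
  have h_half : M / a ≤ m / 2 := by
    rw [div_le_div_iff₀ ha two_pos]
    linarith [(div_le_iff₀ hm).1 h]
  linarith

end Estimate

end L2Division

theorem mainTheorem2_general {n p : ℕ} (D : Set (Fin n → ℂ)) (hD : IsOpen D)
    (g : Fin p → (Fin n → ℂ) → ℂ) (hg : ∀ i, DifferentiableOn ℂ (g i) D)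
    (hinf : 0 < ⨅ z : D, ∑ i, ‖g i z‖ ^ 2)
    (hsup : BddAbove ((fun z => ∑ i, ‖g i z‖ ^ 2) '' D))
    (hdsup : BddAbove ((fun z => ∑ i, ∑ k, ‖dz k (g i) z‖ ^ 2) '' D)) :
    ∃ a₀ δ : ℝ, 0 < a₀ ∧ 0 < δ ∧ ∀ a : ℝ, a₀ ≤ a →
      ∀ φ ψ : (Fin n → ℂ) → ℝ, φ = quadraticWeight n a →
        LocallyIntegrableOn (fun z => Real.exp (ψ z)) D → IsL2Optimal D ψ →
        (LocallyIntegrableOn (fun z => Real.exp (-ψ z)) D →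
          ∀ u : (dbar D (φ + ψ)).domain, dbar D (φ + ψ) u = 0 →
          ∀ v : (T₂ p D (φ + ψ)).adjoint.domain,
            δ * ‖(u : L2 D (φ + ψ))‖ ^ 2 ≤
              ‖(T₁ D (φ + ψ) g (memLp_top_of_bounded hD (φ + ψ) hg hsup)).adjoint u
                + (T₂ p D (φ + ψ)).adjoint v‖ ^ 2) ∧
        ∀ f : (Fin n → ℂ) → ℂ, DifferentiableOn ℂ f D →
          MemLp f 2 (weightedMeasure D (φ + ψ)) →
          ∃ h : Fin p → (Fin n → ℂ) → ℂ,
            (∀ i, DifferentiableOn ℂ (h i) D ∧ MemLp (h i) 2 (weightedMeasure D (φ + ψ))) ∧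
            ∀ z ∈ D, f z = ∑ i, h i z * g i z := by
  set m := ⨅ z : D, ∑ i, ‖g i z‖ ^ 2
  have hm : ∀ z ∈ D, m ≤ ∑ i, ‖g i z‖ ^ 2 := fun z hz =>
    ciInf_le (f := fun z : D => ∑ i, ‖g i z‖ ^ 2) ⟨0, by rintro _ ⟨z, rfl⟩; positivity⟩ ⟨z, hz⟩
  obtain ⟨M, hM_pos, hM⟩ : ∃ M > 0, ∀ z ∈ D, ∑ i, ∑ k, ‖dz k (g i) z‖ ^ 2 ≤ M := by
    obtain ⟨M, hM⟩ := hdsup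
    exact ⟨max M 1, by positivity, fun z hz => le_max_of_le_left (hM ⟨z, hz, rfl⟩)⟩
  refine ⟨2 * M / m, m / 2, by positivity, by positivity, ?_⟩
  rintro a ha _ ψ rfl h_exp hψ
  have ha_pos : 0 < a := ha.trans_lt' (by positivity)
  have hMa : m / 2 ≤ m - M / a := half_le_sub_div hinf ha_pos ha
  have hg_top := memLp_top_of_bounded hD (quadraticWeight n a + ψ) hg hsup
  have hθ := aemeasurable_of_locallyIntegrableOn_exp
    (locallyIntegrableOn_exp_quadraticWeight_add hD a h_exp)
  refine ⟨fun h_exp_neg u hu v => ?_, fun f => hψ.exists_holomorphic_division hD ha_pos h_exp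
    hg_top hg hm hM (hMa.trans_lt' (half_pos hinf))⟩
  have hu_mem := (mem_bergmanSpace_iff_exists_dbar_eq_zero hD hθ).2 ⟨u.2, hu⟩
  exact (mul_le_mul_of_nonneg_right hMa (sq_nonneg _)).trans
    (hψ.le_norm_sq_adjoint_T₁_add_adjoint_T₂ hD ha_pos h_exp h_exp_neg hg_top hg hm hM hu_mem v)

theorem mainTheorem2 {n p : ℕ} (D : Set (Fin n → ℂ)) (hD : IsOpen D) (hDc : IsConnected D)
    (g : Fin p → (Fin n → ℂ) → ℂ) (hg : ∀ i, DifferentiableOn ℂ (g i) D)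
    (hinf : 0 < ⨅ z : D, ∑ i, ‖g i z‖ ^ 2)
    (hsup : BddAbove ((fun z => ∑ i, ‖g i z‖ ^ 2) '' D))
    (hdsup : BddAbove ((fun z => ∑ i, ∑ k, ‖dz k (g i) z‖ ^ 2) '' D)) :
    ∃ a₀ δ : ℝ, 0 < a₀ ∧ 0 < δ ∧ ∀ a : ℝ, a₀ ≤ a →
      ∀ φ ψ : (Fin n → ℂ) → ℝ, φ = quadraticWeight n a →
        UpperSemicontinuousOn ψ D → IsL2Optimal D ψ →
        (ContinuousOn ψ D →
          ∀ u : (dbar D (φ + ψ)).domain, dbar D (φ + ψ) u = 0 →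
          ∀ v : (T₂ p D (φ + ψ)).adjoint.domain,
            (∀ w : (T₂ p D (φ + ψ)).adjoint.domain, (T₂ p D (φ + ψ)).adjoint w = 0 →
              inner ℂ (w : L2FormTuple p D (φ + ψ)) v = 0) →
            δ * ‖(u : L2 D (φ + ψ))‖ ^ 2 ≤
              ‖(T₁ D (φ + ψ) g (memLp_top_of_bounded hD (φ + ψ) hg hsup)).adjoint u
                + (T₂ p D (φ + ψ)).adjoint v‖ ^ 2) ∧
        ∀ f : (Fin n → ℂ) → ℂ, DifferentiableOn ℂ f D →
          MemLp f 2 (weightedMeasure D (φ + ψ)) →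
          ∃ h : Fin p → (Fin n → ℂ) → ℂ,
            (∀ i, DifferentiableOn ℂ (h i) D ∧ MemLp (h i) 2 (weightedMeasure D (φ + ψ))) ∧
            ∀ z ∈ D, f z = ∑ i, h i z * g i z := by
  obtain ⟨a₀, δ, ha₀, hδ, h⟩ := mainTheorem2_general D hD g hg hinf hsup hdsup
  refine ⟨a₀, δ, ha₀, hδ, fun a ha φ ψ hφ hψ_usc hψ => ?_⟩
  obtain ⟨h_est, h_div⟩ := h a ha φ ψ hφ
    (locallyIntegrableOn_exp_of_upperSemicontinuousOn hD.measurableSet hψ_usc) hψ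
  exact ⟨fun hψ_cont u hu v _ =>
    h_est (hψ_cont.neg.rexp.locallyIntegrableOn hD.measurableSet) u hu v, h_div⟩
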